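/- **Setting.** Fix $x_0<0$, $[\underline k,\overline k]\subset(0,\infty)$ with $\underline k<\overline k$, and $R>0$. Let $c^*\in C^2(\mathbb R)$ satisfy $c^*\ge 1$ and $c^*=1$ outside $(0,1)$. For each $k>0$ let $u^*(\cdot,k)$ solve $$u''+k^2c^*(x)u=-\delta(x-x_0)\ \text{ on }\mathbb R,\qquad \lim_{x\to\infty}(u'+iku)=0,\quad \lim_{x\to-\infty}(u'-iku)=0,$$ where $\delta(\cdot-x_0)$ is the Dirac mass at $x_0$. Put $u_0(x,k)=e^{-ik|x-x_0|}/(2ik)$, $w^*=u^*/u_0$ and $g_0^*(k)=w^*(0,k)$. For $x\in[0,1]$, $\log w^*(x,k)$ denotes the branch that is continuous in $k>0$ and satisfies, as $k\to\infty$, $$\log w^*(x,k)=-\tfrac14\ln c^*(x)-ik\Big(\int_{x_0}^x\sqrt{c^*(\xi)}\,d\xi-x+x_0\Big)+o(1).$$ Let $V^*(x)=\overline k^{-2}\log w^*(x,\overline k)$ be the exact tail function and put $r^*(x)=\overline k\,V^*(x)$ for $x\in[0,1]$. *Noisy data.* Let $0<\delta\le 1$ and let $g_0\in C^1[\underline k,\overline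 k]$ be a nowhere vanishing complex-valued function with a continuous branch $\log g_0$ such that, for all $k\in[\underline k,\overline k]$, $$|\log g_0(k)-\log g_0^*(k)|\le\delta,\quad |g_0(k)-g_0^*(k)|\le\delta,\quad |g_0'(k)-(g_0^*)'(k)|\le\delta .$$ Let $V_{\alpha}$, $\alpha=\delta^2$, be the minimizer of $\frac12\big(\|V''\|^2_{L^2(0,1)}+\alpha\|V\|^2_{H^3(0,1)}\big)$ over all complex-valued $V\in H^3(0,1)$ with $$V(0)=\frac{\log g_0(\overline k)}{\overline k^2},\quad V'(0)=\frac{2i}{\overline k}\Big(1-\frac1{g_0(\overline k)}\Big),\quad V'(1)=0.$$ Put $p_0(k)=\partial_k\big(k^{-2}\log g_0(k)\big)$, $p_1(k)=\partial_k\big[\frac{2i}{k}\big(1-\frac1{g_0(k)}\big)\big]$ and $m(x,k)=(x^2-1)^2p_0(k)+x(x^2-1)^2p_1(k)$. *The functional.* Let $H$ be the real Hilbert space of complex-valued functions (pairs of real-valued functions) $p(x,k)$ on $(0,1)\times(\underline k,\overline k)$ with $p(0,k)=p'(0,k)=p'(1,k)=0$ and $\|p\|_H^2=\int_{\underline k}^{\overline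 k}\|p(\cdot,k)\|^2_{H^2(0,1)}dk<\infty$, where the prime denotes $\partial_x$. Let $B(R)=\{p\in H:\|p\|_H<R\}$, with closure $\overline{B(R)}$. For $p\in H$ put $$T_p(x,k)=-\int_k^{\overline k}(p'+m')(x,\tau)\,d\tau+V_\alpha'(x),$$ $$L(p)=p''+m''-2ik(p'+m')+2k^2(p'+m')T_p-2iT_p+2kT_p^2,$$ $$J_\lambda(p)=e^{2\lambda}\int_{\underline k}^{\overline k}\int_0^1|L(p)|^2e^{-2\lambda x}\,dx\,dk .$$ **Theorem 5.1.** For every $\lambda>0$, $J_\lambda$ is Fréchet differentiable on $H$, and its derivative, identified with an element $J_\lambda'(p)\in H$ by the Riesz theorem, is Lipschitz continuous on $\overline{B(R)}$: there is a constant $C_2>0$, depending only on $r^*$, $\underline k$, $\overline k$, an upper bound for $\|p_1\|_{C[\underline k,\overline k]}$, and $R$ (and on the fixed source position $x_0$), such that $$\|J_\lambda'(p^{(1)})-J_\lambda'(p^{(2)})\|_H\le C_2e^{2\lambda}\|p^{(1)}-p^{(2)}\|_H\qquad\text{for all }p^{(1)},p^{(2)}\in\overline{B(R)}\text{ and all }\lambda>0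 .$$ -/

import Mathlib

open MeasureTheory Filter Topology Set
open scoped ENNReal

noncomputable section

namespace HelmholtzCIP

/-! ### The forward problem -/

/-- The dielectric constant: `c ∈ C²(ℝ)`, `c ≥ 1`, and `c = 1` outside `(0, 1)`. -/
structure IsDielectric (c : ℝ → ℝ) : Prop where
  contDiff : ContDiff ℝ 2 c
  one_le : ∀ x, 1 ≤ c x
  eq_one : ∀ x, x ∉ Ioo (0 : ℝ) 1 → c x = 1

/-- `u` solves `u'' + k² c u = -δ(x - x₀)` on `ℝ` with the radiation conditions
`u' + i k u → 0` at `+∞` and `u' - i k u → 0` at `-∞`. As usual in one dimension, the equation with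
the point source means: `u` is continuous, solves the homogeneous equation classically off `x₀`,
and `u'` jumps by `-1` at `x₀`. -/
structure IsHelmholtzSolution (c : ℝ → ℝ) (x₀ k : ℝ) (u : ℝ → ℂ) : Prop where
  continuous : Continuous u
  contDiffOn : ContDiffOn ℝ 2 u {x₀}ᶜ
  equation : ∀ x, x ≠ x₀ → deriv (deriv u) x + (k : ℂ) ^ 2 * (c x : ℂ) * u x = 0
  jump : ∃ a b : ℂ, Tendsto (deriv u) (𝓝[>] x₀) (𝓝 a) ∧ Tendsto (deriv u) (𝓝[<] x₀) (𝓝 b) ∧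
    a - b = -1
  radiation_right : Tendsto (fun x => deriv u x + Complex.I * k * u x) atTop (𝓝 0)
  radiation_left : Tendsto (fun x => deriv u x - Complex.I * k * u x) atBot (𝓝 0)

/-- The solution `u₀(x, k) = exp(-i k |x - x₀|) / (2 i k)` for `c ≡ 1`. -/
def u₀ (x₀ x k : ℝ) : ℂ :=
  Complex.exp (-(Complex.I * k * |x - x₀|)) / (2 * Complex.I * k)

/-- The normalized field `w = u / u₀`. -/
def wave (x₀ : ℝ) (u : ℝ → ℝ → ℂ) (x k : ℝ) : ℂ := u x k / u₀ x₀ x k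

/-- `ψ(x, k)` is the function `log w(x, k)`, for `x ∈ [0, 1]` and `k > 0`: the branch of the
logarithm that is continuous in `k` and satisfies, as `k → ∞`,
`log w(x, k) = -(1/4) ln c(x) - i k (∫_{x₀}^x √c - x + x₀) + o(1)`. These requirements determine
it uniquely. -/
structure IsLogWave (c : ℝ → ℝ) (x₀ : ℝ) (w ψ : ℝ → ℝ → ℂ) : Prop where
  continuousOn : ∀ x ∈ Icc (0 : ℝ) 1, ContinuousOn (ψ x) (Ioi 0)
  exp_eq : ∀ x ∈ Icc (0 : ℝ) 1, ∀ k : ℝ, 0 < k → Complex.exp (ψ x k) = w x k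
  asymptotics : ∀ x ∈ Icc (0 : ℝ) 1, Tendsto
    (fun k : ℝ => ψ x k - (-(1 / 4 : ℂ) * (Real.log (c x) : ℂ)
      - Complex.I * k * (((∫ ξ in x₀..x, Real.sqrt (c ξ)) - x + x₀ : ℝ) : ℂ))) atTop (𝓝 0)

/-! ### The measured data and the approximate tail function -/

/-- `g₀ ∈ C¹[k₁, k₂]` together with a continuous branch `ℓ` of `log g₀` on `[k₁, k₂]`. -/
structure IsData (k₁ k₂ : ℝ) (g₀ ℓ : ℝ → ℂ) : Prop where
  contDiffOn : ContDiffOn ℝ 1 g₀ (Icc k₁ k₂)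
  continuousOn_log : ContinuousOn ℓ (Icc k₁ k₂)
  exp_log : ∀ k ∈ Icc k₁ k₂, Complex.exp (ℓ k) = g₀ k

/-- The data `g₀, log g₀` differ from the noiseless ones `g₀*, log g₀*` by at most `δ`, and so do
the `k`-derivatives of `g₀` and `g₀*`. -/
def NoiseLevel (k₁ k₂ δ : ℝ) (g₀ ℓ gs ℓs : ℝ → ℂ) : Prop :=
  ∀ k ∈ Icc k₁ k₂, ‖ℓ k - ℓs k‖ ≤ δ ∧ ‖g₀ k - gs k‖ ≤ δ ∧
    ‖derivWithin g₀ (Icc k₁ k₂) k - derivWithin gs (Icc k₁ k₂) k‖ ≤ δ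

/-- `D 0 ∈ H^m(0, 1)` with derivatives `D 1, …, D m`: each `D j`, `j < m`, is absolutely continuous
on `[0, 1]` with derivative `D (j + 1)`, and `D m ∈ L²(0, 1)`. This is the description of
`H^m(0, 1)` by continuous representatives; the `D j`, `j < m`, are genuine functions on `[0, 1]`,
so boundary values are plain values. -/
structure IsSobolev (m : ℕ) (D : ℕ → ℝ → ℂ) : Prop where
  memLp : MemLp (D m) 2 (volume.restrict (Ioo (0 : ℝ) 1))
  primitive : ∀ j < m, ∀ x ∈ Icc (0 : ℝ) 1, D j x = D j 0 + ∫ t in (0 : ℝ)..x, D (j + 1) t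

/-- `(1/2) (‖V''‖²_{L²(0,1)} + α ‖V‖²_{H³(0,1)})` with `V^{(j)} = D j`. -/
def qrmFunctional (α : ℝ) (D : ℕ → ℝ → ℂ) : ℝ :=
  (1 / 2) * ((∫ x in (0 : ℝ)..1, ‖D 2 x‖ ^ 2) +
    α * ∑ j ∈ Finset.range 4, ∫ x in (0 : ℝ)..1, ‖D j x‖ ^ 2)

/-- The set `W` of `V ∈ H³(0, 1)` with `V(0) = log g₀(k₂) / k₂²`,
`V'(0) = (2 i / k₂) (1 - 1 / g₀(k₂))` and `V'(1) = 0`. -/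
def qrmSet (k₂ : ℝ) (g₀ ℓ : ℝ → ℂ) : Set (ℕ → ℝ → ℂ) :=
  {D | IsSobolev 3 D ∧ D 0 0 = ℓ k₂ / (k₂ : ℂ) ^ 2 ∧
    D 1 0 = 2 * Complex.I / k₂ * (1 - 1 / g₀ k₂) ∧ D 1 1 = 0}

/-- `D 0` (with derivatives `D 1, D 2, D 3`) minimizes the quasi-reversibility functional
on `W`. -/
def IsTailMinimizer (α k₂ : ℝ) (g₀ ℓ : ℝ → ℂ) (D : ℕ → ℝ → ℂ) : Prop :=
  D ∈ qrmSet k₂ g₀ ℓ ∧ ∀ D' ∈ qrmSet k₂ g₀ ℓ, qrmFunctional α D ≤ qrmFunctional α D'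

/-- `p₀(k) = ∂_k (log g₀(k) / k²)`. -/
def p₀ (k₁ k₂ : ℝ) (ℓ : ℝ → ℂ) (k : ℝ) : ℂ :=
  derivWithin (fun s : ℝ => ℓ s / (s : ℂ) ^ 2) (Icc k₁ k₂) k

/-- `p₁(k) = ∂_k [(2 i / k) (1 - 1 / g₀(k))]`. -/
def p₁ (k₁ k₂ : ℝ) (g₀ : ℝ → ℂ) (k : ℝ) : ℂ :=
  derivWithin (fun s : ℝ => 2 * Complex.I / (s : ℂ) * (1 - 1 / g₀ s)) (Icc k₁ k₂) k

/-- `m(x, k) = (x² - 1)² p₀(k) + x (x² - 1)² p₁(k)`. -/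
def m (k₁ k₂ : ℝ) (g₀ ℓ : ℝ → ℂ) (x k : ℝ) : ℂ :=
  ((x : ℂ) ^ 2 - 1) ^ 2 * p₀ k₁ k₂ ℓ k + (x : ℂ) * ((x : ℂ) ^ 2 - 1) ^ 2 * p₁ k₁ k₂ g₀ k

/-- `∂_x m`. -/
def mx (k₁ k₂ : ℝ) (g₀ ℓ : ℝ → ℂ) (x k : ℝ) : ℂ :=
  deriv (fun y => m k₁ k₂ g₀ ℓ y k) x

/-- `∂_x² m`. -/
def mxx (k₁ k₂ : ℝ) (g₀ ℓ : ℝ → ℂ) (x k : ℝ) : ℂ :=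
  deriv (fun y => mx k₁ k₂ g₀ ℓ y k) x

/-! ### The Hilbert space `H` -/

/-- Complex valued `L²(0, 1)`, used as a real Hilbert space (pairs of real valued functions). -/
abbrev L2 : Type := Lp ℂ 2 (volume.restrict (Ioo (0 : ℝ) 1))

/-- `f` has the absolutely continuous representative on `[0, 1]` with value `a` at `0` and
derivative `g`. -/
def IsPrimitive (f g : ℝ → ℂ) (a : ℂ) : Prop :=
  ∀ᵐ x ∂(volume.restrict (Ioo (0 : ℝ) 1)), f x = a + ∫ t in (0 : ℝ)..x, g t

lemma L2.intervalIntegrable (f : L2) {x : ℝ} (hx : x ∈ Icc (0 : ℝ) 1) :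
    IntervalIntegrable f volume 0 x := by
  have h : Integrable f (volume.restrict (Ioo (0 : ℝ) 1)) :=
    (Lp.memLp f).integrable (by norm_num)
  rw [intervalIntegrable_iff_integrableOn_Ioo_of_le hx.1]
  exact IntegrableOn.mono_set h (Ioo_subset_Ioo_right hx.2)

lemma L2.coeFn_congr {f g : ℝ → ℂ} (h : f =ᵐ[volume.restrict (Ioo (0 : ℝ) 1)] g) {x : ℝ}
    (hx : x ∈ Icc (0 : ℝ) 1) : ∫ t in (0 : ℝ)..x, f t = ∫ t in (0 : ℝ)..x, g t := by
  rw [intervalIntegral.integral_of_le hx.1, intervalIntegral.integral_of_le hx.1,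
    integral_Ioc_eq_integral_Ioo, integral_Ioc_eq_integral_Ioo]
  exact integral_congr_ae (ae_mono (Measure.restrict_mono (Ioo_subset_Ioo_right hx.2) le_rfl) h)

lemma L2.integral_add (f g : L2) {x : ℝ} (hx : x ∈ Icc (0 : ℝ) 1) :
    ∫ t in (0 : ℝ)..x, (f + g : L2) t
      = (∫ t in (0 : ℝ)..x, f t) + ∫ t in (0 : ℝ)..x, g t := by
  rw [L2.coeFn_congr (Lp.coeFn_add f g) hx]
  exact intervalIntegral.integral_add (f.intervalIntegrable hx) (g.intervalIntegrable hx)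

lemma L2.integral_smul (a : ℝ) (f : L2) {x : ℝ} (hx : x ∈ Icc (0 : ℝ) 1) :
    ∫ t in (0 : ℝ)..x, (a • f : L2) t = a • ∫ t in (0 : ℝ)..x, f t := by
  rw [L2.coeFn_congr (Lp.coeFn_smul a f) hx]
  exact intervalIntegral.integral_smul a _

lemma L2.integral_zero {x : ℝ} (hx : x ∈ Icc (0 : ℝ) 1) :
    ∫ t in (0 : ℝ)..x, (0 : L2) t = 0 := by
  rw [L2.coeFn_congr (Lp.coeFn_zero ℂ 2 _) hx]
  simp

lemma L2.continuous_integral {x : ℝ} (hx : x ∈ Icc (0 : ℝ) 1) :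
    Continuous fun f : L2 => ∫ t in (0 : ℝ)..x, f t := by
  have hs : MeasurableSet (Ioo (0 : ℝ) x) := measurableSet_Ioo
  have hμ : (volume.restrict (Ioo (0 : ℝ) 1)) (Ioo (0 : ℝ) x) ≠ ∞ := measure_ne_top _ _
  have h : (fun f : L2 => ∫ t in (0 : ℝ)..x, f t)
      = fun f : L2 => inner ℂ (indicatorConstLp 2 hs hμ (1 : ℂ)) f := by
    funext f
    rw [L2.inner_indicatorConstLp_one, intervalIntegral.integral_of_le hx.1,
      integral_Ioc_eq_integral_Ioo, Measure.restrict_restrict hs,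
      inter_eq_left.2 (Ioo_subset_Ioo_right hx.2)]
  rw [h]
  fun_prop

lemma ae_mem_Icc : ∀ᵐ x ∂(volume.restrict (Ioo (0 : ℝ) 1)), x ∈ Icc (0 : ℝ) 1 := by
  filter_upwards [ae_restrict_mem measurableSet_Ioo] with x hx using Ioo_subset_Icc_self hx

/-- The space of `f ∈ H²(0, 1)` with `f(0) = f'(0) = f'(1) = 0`. An element is stored as the triple
`(f, f', f'')`, so the inherited norm is
`‖f‖²_{H²} = ‖f‖²_{L²} + ‖f'‖²_{L²} + ‖f''‖²_{L²}`. Since `f'(0) = 0`, the condition `f'(1) = 0`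
reads `∫₀¹ f'' = 0`. -/
def H2zero : Submodule ℝ (PiLp 2 (fun _ : Fin 3 => L2)) where
  carrier := {F | IsPrimitive (F 0) (F 1) 0 ∧ IsPrimitive (F 1) (F 2) 0 ∧
    ∫ t in (0 : ℝ)..1, F 2 t = 0}
  add_mem' := by
    rintro F G ⟨h1, h2, h3⟩ ⟨h1', h2', h3'⟩
    refine ⟨?_, ?_, ?_⟩
    · filter_upwards [h1, h1', Lp.coeFn_add (F 0) (G 0), ae_mem_Icc] with x a b c d
      simp only [PiLp.add_apply]
      rw [c, Pi.add_apply, a, b, L2.integral_add _ _ d]; ring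
    · filter_upwards [h2, h2', Lp.coeFn_add (F 1) (G 1), ae_mem_Icc] with x a b c d
      simp only [PiLp.add_apply]
      rw [c, Pi.add_apply, a, b, L2.integral_add _ _ d]; ring
    · simp only [PiLp.add_apply]
      rw [L2.integral_add _ _ (by simp), h3, h3', add_zero]
  zero_mem' := by
    refine ⟨?_, ?_, ?_⟩
    · filter_upwards [Lp.coeFn_zero ℂ 2 (volume.restrict (Ioo (0 : ℝ) 1)), ae_mem_Icc] with x a d
      simp only [PiLp.zero_apply]
      rw [a, L2.integral_zero d]; simp
    · filter_upwards [Lp.coeFn_zero ℂ 2 (volume.restrict (Ioo (0 : ℝ) 1)), ae_mem_Icc] with x a d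
      simp only [PiLp.zero_apply]
      rw [a, L2.integral_zero d]; simp
    · simp only [PiLp.zero_apply]
      exact L2.integral_zero (by simp)
  smul_mem' := by
    rintro r F ⟨h1, h2, h3⟩
    refine ⟨?_, ?_, ?_⟩
    · filter_upwards [h1, Lp.coeFn_smul r (F 0), ae_mem_Icc] with x a c d
      simp only [PiLp.smul_apply]
      rw [c, Pi.smul_apply, a, L2.integral_smul _ _ d]; simp
    · filter_upwards [h2, Lp.coeFn_smul r (F 1), ae_mem_Icc] with x a c d
      simp only [PiLp.smul_apply]
      rw [c, Pi.smul_apply, a, L2.integral_smul _ _ d]; simp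
    · simp only [PiLp.smul_apply]
      rw [L2.integral_smul _ _ (by simp), h3, smul_zero]

lemma isPrimitive_of_tendsto {f g : L2} {f' g' : ℕ → L2} (h : ∀ n, IsPrimitive (f' n) (g' n) 0)
    (hf : Tendsto f' atTop (𝓝 f)) (hg : Tendsto g' atTop (𝓝 g)) : IsPrimitive f g 0 := by
  obtain ⟨ns, hns, hae⟩ := (tendstoInMeasure_of_tendsto_Lp hf).exists_seq_tendsto_ae
  filter_upwards [hae, ae_all_iff.2 h, ae_mem_Icc] with x hx hn hI
  refine tendsto_nhds_unique hx ?_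
  simp only [hn, zero_add]
  exact (((L2.continuous_integral hI).tendsto g).comp hg).comp hns.tendsto_atTop

lemma isClosed_H2zero : IsClosed (H2zero : Set (PiLp 2 (fun _ : Fin 3 => L2))) := by
  refine IsSeqClosed.isClosed fun F G hF hG => ?_
  have hc : ∀ i : Fin 3, Tendsto (fun n => F n i) atTop (𝓝 (G i)) := fun i =>
    ((PiLp.continuous_apply 2 (fun _ : Fin 3 => L2) i).tendsto G).comp hG
  refine ⟨isPrimitive_of_tendsto (fun n => (hF n).1) (hc 0) (hc 1),
    isPrimitive_of_tendsto (fun n => (hF n).2.1) (hc 1) (hc 2), ?_⟩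
  refine tendsto_nhds_unique
    (((L2.continuous_integral (x := 1) (by simp)).tendsto (G 2)).comp (hc 2)) ?_
  have : ((fun f : L2 => ∫ t in (0 : ℝ)..1, f t) ∘ fun n => F n 2) = fun _ => (0 : ℂ) := by
    funext n
    exact (hF n).2.2
  rw [this]
  exact tendsto_const_nhds

instance : CompleteSpace H2zero := isClosed_H2zero.completeSpace_coe

/-- The real Hilbert space `H` of functions `f(x, k)`, `(x, k) ∈ (0, 1) × (k₁, k₂)`, with
`f(0, k) = f'(0, k) = f'(1, k) = 0` and `‖f‖²_H = ∫_{k₁}^{k₂} ‖f(·, k)‖²_{H²(0,1)} dk < ∞`. -/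
abbrev H (k₁ k₂ : ℝ) : Type := Lp H2zero 2 (volume.restrict (Ioo k₁ k₂))

variable {k₁ k₂ : ℝ}

/-- `p''(x, k)`. -/
def dxx (p : H k₁ k₂) (x k : ℝ) : ℂ := (p k : PiLp 2 (fun _ : Fin 3 => L2)) 2 x

/-- `p'(x, k)`: the continuous representative in `x`, which by `p'(0, k) = 0` is
`∫₀ˣ p''(t, k) dt`. -/
def dx (p : H k₁ k₂) (x k : ℝ) : ℂ := ∫ t in (0 : ℝ)..x, dxx p t k

/-! ### The weighted cost functional -/

/-- `-∫_k^{k₂} (p' + m')(x, τ) dτ + V'(x)`. -/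
def tailTerm (g₀ ℓ : ℝ → ℂ) (V' : ℝ → ℂ) (p : H k₁ k₂) (x k : ℝ) : ℂ :=
  -(∫ τ in k..k₂, (dx p x τ + mx k₁ k₂ g₀ ℓ x τ)) + V' x

/-- The nonlinear integro-differential operator `L(p)`. -/
def opL (g₀ ℓ : ℝ → ℂ) (V' : ℝ → ℂ) (p : H k₁ k₂) (x k : ℝ) : ℂ :=
  dxx p x k + mxx k₁ k₂ g₀ ℓ x k
    - 2 * Complex.I * k * (dx p x k + mx k₁ k₂ g₀ ℓ x k)
    + 2 * (k : ℂ) ^ 2 * (dx p x k + mx k₁ k₂ g₀ ℓ x k) * tailTerm g₀ ℓ V' p x k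
    - 2 * Complex.I * tailTerm g₀ ℓ V' p x k
    + 2 * (k : ℂ) * tailTerm g₀ ℓ V' p x k ^ 2

/-- `J_λ(p) = e^{2λ} ∫_{k₁}^{k₂} ∫₀¹ |L(p)|² e^{-2λx} dx dk`. -/
def J (g₀ ℓ : ℝ → ℂ) (V' : ℝ → ℂ) (lam : ℝ) (p : H k₁ k₂) : ℝ :=
  Real.exp (2 * lam) *
    ∫ k in k₁..k₂, ∫ x in (0 : ℝ)..1, ‖opL g₀ ℓ V' p x k‖ ^ 2 * Real.exp (-(2 * lam * x))

end HelmholtzCIP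

end

/-!
The operator `L(p)` is a quadratic polynomial in `p`, with coefficients controlled by the data, so
`J_λ`, the squared norm of `L(p)` multiplied by a weight, is smooth with a gradient that is
Lipschitz on bounded sets. The point is that the constant can be chosen before the data.

*The data.* Everything that enters `L` is bounded in terms of `k₁`, `k₂`, the bound `M` for `p₁`
and `r*(0)`. To the left of the inhomogeneity the field consists of the wave emitted by the source,
whose amplitude is fixed by the jump condition, and a reflected wave, which by conservation of the
energy flux is not stronger. This gives `|g₀*| ≤ 2` (`norm_wave_zero_le`), hence `|g₀| ≤ 3`. Since
`(log g₀)' = (k / 2i) (g₀ p₁ + 2i k⁻² (g₀ - 1))`, and `log g₀(k₂)` is within `δ` of `k₂ r*(0)`, the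
functions `log g₀` and `p₀` are bounded. Comparing the minimizer `V_α` with a quadratic polynomial
bounds `V_α''` in `L²`, hence `V_α'` in `C[0, 1]`. The result is `exists_data_bound`.

*The functional.* For `p ∈ H` only `k ↦ p(·, k) ∈ H²(0, 1)` is measurable, as a function with values
in a Hilbert space; the representatives `p''(x, k)` need not be jointly measurable in `(x, k)`.
Therefore all integrals in `k` are taken with values in function spaces of `x`. The triple
`(p'' + m'', p' + m', T_p)` lies in `L²(L²(0, 1)) × L²(C[0, 1]) × L^∞(C[0, 1])` and is an affine
function of `p`: its linear part `tripleLinear` depends on `k₁` and `k₂` only, and its shift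
`tripleShift` is bounded by the data. By Hölder's inequality `L` is a fixed continuous linear map
plus the diagonal of a fixed continuous bilinear map of the triple. So `J_λ(p) = e^{2λ} ‖W N(z)‖²`
(`J_eq`) with `W` the contraction `e^{-λx}`, `N` a fixed quadratic map and `z` affine in `p`, and
`exists_lipschitz_gradient_norm_sq` applies; the only `λ`-dependent factor that remains is `e^{2λ}`.
-/

noncomputable section

namespace HelmholtzCIP

/-! ### A priori bound for the forward problem -/

lemma eq_of_hasDerivAt_zero {E : Type*} [NormedAddCommGroup E] [NormedSpace ℝ E] {f : ℝ → E}
    {s : Set ℝ} (hs : Convex ℝ s) (hf : ∀ x ∈ s, HasDerivAt f 0 x) {x y : ℝ} (hx : x ∈ s)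
    (hy : y ∈ s) : f x = f y := by
  have h := hs.norm_image_sub_le_of_norm_hasDerivWithin_le (f := f) (f' := fun _ => 0) (C := 0)
    (fun z hz => (hf z hz).hasDerivWithinAt) (by simp) hx hy
  rw [zero_mul, norm_le_zero_iff, sub_eq_zero] at h
  exact h.symm

namespace IsHelmholtzSolution

variable {c : ℝ → ℝ} {x₀ k : ℝ} {u : ℝ → ℂ}

lemma hasDerivAt (hu : IsHelmholtzSolution c x₀ k u) {x : ℝ} (hx : x ≠ x₀) :
    HasDerivAt u (deriv u x) x := by
  have h := hu.contDiffOn.contDiffAt (isOpen_compl_singleton.mem_nhds hx)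
  exact (h.differentiableAt (by norm_num)).hasDerivAt

lemma hasDerivAt_deriv (hu : IsHelmholtzSolution c x₀ k u) {x : ℝ} (hx : x ≠ x₀) :
    HasDerivAt (deriv u) (-((k : ℂ) ^ 2 * (c x : ℂ) * u x)) x := by
  have h : DifferentiableAt ℝ (deriv u) x :=
    ((hu.contDiffOn.deriv_of_isOpen isOpen_compl_singleton
      (by norm_num : (1 : WithTop ℕ∞) + 1 ≤ 2)).contDiffAt
      (isOpen_compl_singleton.mem_nhds hx)).differentiableAt (by norm_num)
  rw [← eq_neg_of_add_eq_zero_left (hu.equation x hx)]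
  exact h.hasDerivAt

/-- Where `c = 1`, the amplitude `(u' + σ k u) exp(-σ k x)`, `σ = ± i`, of each of the two plane
waves is constant. -/
lemma hasDerivAt_amplitude (hu : IsHelmholtzSolution c x₀ k u) {σ : ℂ} (hσ : σ ^ 2 = -1) {x : ℝ}
    (hx : x ≠ x₀) (hc : c x = 1) :
    HasDerivAt (fun y : ℝ => (deriv u y + σ * k * u y) * Complex.exp (-(σ * k * y))) 0 x := by
  have h1 : HasDerivAt (fun y : ℝ => Complex.exp (-(σ * k * y)))
      (Complex.exp (-(σ * k * x)) * -(σ * k * 1)) x :=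
    (((Complex.ofRealCLM.hasDerivAt (x := x)).const_mul (σ * k)).neg).cexp
  refine (((hu.hasDerivAt_deriv hx).add ((hu.hasDerivAt hx).const_mul (σ * k))).mul h1).congr_deriv
    ?_
  rw [hc]
  simp only [Pi.add_apply]
  push_cast
  linear_combination (-(k : ℂ) ^ 2 * u x * Complex.exp (-(σ * k * x))) * hσ

/-- The energy flux `Im (u' ū)` is constant away from the source. -/
lemma hasDerivAt_flux (hu : IsHelmholtzSolution c x₀ k u) {x : ℝ} (hx : x ≠ x₀) :
    HasDerivAt (fun y : ℝ => (deriv u y * (starRingEnd ℂ) (u y)).im) 0 x := by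
  have h1 : HasDerivAt (fun y => (starRingEnd ℂ) (u y)) ((starRingEnd ℂ) (deriv u x)) x :=
    (hu.hasDerivAt hx).star
  have h2 := (Complex.imCLM.hasFDerivAt.comp_hasDerivAt x ((hu.hasDerivAt_deriv hx).mul h1))
  refine h2.congr_deriv ?_
  have h3 : -((k : ℂ) ^ 2 * (c x : ℂ) * u x) * (starRingEnd ℂ) (u x)
        + deriv u x * (starRingEnd ℂ) (deriv u x)
      = ((-(k ^ 2 * c x * Complex.normSq (u x)) + Complex.normSq (deriv u x) : ℝ) : ℂ) := by
    rw [Complex.mul_conj, neg_mul, mul_assoc, Complex.mul_conj]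
    push_cast; ring
  rw [h3]
  rw [Complex.imCLM_apply, Complex.ofReal_im]

lemma norm_exp_I_mul (σ : ℂ) (hσ : σ = Complex.I ∨ σ = -Complex.I) (k x : ℝ) :
    ‖Complex.exp (-(σ * k * x))‖ = 1 := by
  rw [Complex.norm_exp]
  rcases hσ with rfl | rfl <;> simp

/-- No incoming wave on the right of the inhomogeneity. -/
lemma outgoing_right (hu : IsHelmholtzSolution c x₀ k u) (hx₀ : x₀ < 0)
    (hc : ∀ x, 1 ≤ x → c x = 1) : deriv u 1 + Complex.I * k * u 1 = 0 := by
  have hconst : ∀ x : ℝ, 1 ≤ x →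
      (deriv u x + Complex.I * k * u x) * Complex.exp (-(Complex.I * k * x))
        = (deriv u 1 + Complex.I * k * u 1) * Complex.exp (-(Complex.I * k * (1 : ℝ))) :=
    fun x hx => eq_of_hasDerivAt_zero (convex_Ici (1 : ℝ))
      (fun y hy => hu.hasDerivAt_amplitude Complex.I_sq
        (by have := mem_Ici.1 hy; linarith) (hc y hy)) hx self_mem_Ici
  have hlim : Tendsto (fun x : ℝ => ‖deriv u x + Complex.I * k * u x‖) atTop (𝓝 0) := by
    simpa using hu.radiation_right.norm
  have hlim' : Tendsto (fun _ : ℝ => ‖deriv u 1 + Complex.I * k * u 1‖) atTop (𝓝 0) := by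
    refine hlim.congr' ?_
    filter_upwards [eventually_ge_atTop 1] with x hx
    have := congrArg norm (hconst x hx)
    rwa [norm_mul, norm_mul, norm_exp_I_mul _ (Or.inl rfl), norm_exp_I_mul _ (Or.inl rfl), mul_one,
      mul_one] at this
  exact norm_eq_zero.1 (tendsto_nhds_unique tendsto_const_nhds hlim')

/-- On the left of the source the field consists of the outgoing wave only. -/
lemma outgoing_left (hu : IsHelmholtzSolution c x₀ k u) (hc : ∀ x, x < x₀ → c x = 1) {x : ℝ}
    (hx : x < x₀) : deriv u x - Complex.I * k * u x = 0 := by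
  have hconst : ∀ y : ℝ, y < x₀ →
      (deriv u y + -Complex.I * k * u y) * Complex.exp (-(-Complex.I * k * y))
        = (deriv u x + -Complex.I * k * u x) * Complex.exp (-(-Complex.I * k * x)) :=
    fun y hy => eq_of_hasDerivAt_zero (convex_Iio x₀)
      (fun z hz => hu.hasDerivAt_amplitude (by simp) (ne_of_lt hz) (hc z hz)) hy hx
  have hlim : Tendsto (fun y : ℝ => ‖deriv u y - Complex.I * k * u y‖) atBot (𝓝 0) := by
    simpa using hu.radiation_left.norm
  have hlim' : Tendsto (fun _ : ℝ => ‖deriv u x - Complex.I * k * u x‖) atBot (𝓝 0) := by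
    refine hlim.congr' ?_
    filter_upwards [eventually_lt_atBot x₀] with y hy
    have := congrArg norm (hconst y hy)
    rw [norm_mul, norm_mul, norm_exp_I_mul _ (Or.inr rfl), norm_exp_I_mul _ (Or.inr rfl), mul_one,
      mul_one] at this
    rw [sub_eq_add_neg, sub_eq_add_neg, ← neg_mul, ← neg_mul, ← neg_mul, ← neg_mul]
    exact this
  exact norm_eq_zero.1 (tendsto_nhds_unique tendsto_const_nhds hlim')

/-- The jump condition fixes the modulus of the wave emitted by the source to the right. -/
lemma norm_incident (hu : IsHelmholtzSolution c x₀ k u) (hx₀ : x₀ < 0)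
    (hc : ∀ x, x ≤ 0 → c x = 1) : ‖deriv u 0 - Complex.I * k * u 0‖ = 1 := by
  obtain ⟨a, b, ha, hb, hab⟩ := hu.jump
  have hu₀ : Tendsto u (𝓝 x₀) (𝓝 (u x₀)) := hu.continuous.tendsto x₀
  have hb' : b - Complex.I * k * u x₀ = 0 := by
    refine tendsto_nhds_unique
      (hb.sub ((hu₀.mono_left nhdsWithin_le_nhds).const_mul (Complex.I * k))) ?_
    refine tendsto_const_nhds.congr' ?_
    filter_upwards [self_mem_nhdsWithin] with y hy
    exact (hu.outgoing_left (fun x hx => hc x (by linarith)) hy).symm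
  have ha' : Tendsto (fun y => ‖deriv u y - Complex.I * k * u y‖) (𝓝[>] x₀) (𝓝 1) := by
    have h := (ha.sub ((hu₀.mono_left nhdsWithin_le_nhds).const_mul (Complex.I * k))).norm
    have h1 : a - Complex.I * k * u x₀ = -1 := by linear_combination hab + hb'
    simpa [h1] using h
  refine tendsto_nhds_unique ?_ ha'
  refine tendsto_const_nhds.congr' ?_
  filter_upwards [Ioc_mem_nhdsGT hx₀] with y hy
  have := congrArg norm (eq_of_hasDerivAt_zero (convex_Ioc x₀ 0)
      (fun z hz => hu.hasDerivAt_amplitude (σ := -Complex.I) (by simp) (ne_of_gt hz.1) (hc z hz.2))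
      (right_mem_Ioc.2 hx₀) hy)
  rw [norm_mul, norm_mul, norm_exp_I_mul _ (Or.inr rfl), norm_exp_I_mul _ (Or.inr rfl), mul_one,
      mul_one] at this
  rw [sub_eq_add_neg, sub_eq_add_neg, ← neg_mul, ← neg_mul, ← neg_mul, ← neg_mul]
  exact this

lemma norm_sq_add_I_mul (z w : ℂ) (k : ℝ) :
    ‖z + Complex.I * k * w‖ ^ 2 - ‖z - Complex.I * k * w‖ ^ 2
      = 4 * k * (z * (starRingEnd ℂ) w).im := by
  simp only [Complex.sq_norm, Complex.normSq_apply]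
  simp
  ring

/-- At the origin the reflected wave is at most as strong as the incident one: by conservation of
the energy flux, since on the right only an outgoing wave is left. -/
lemma norm_zero_le (hu : IsHelmholtzSolution c x₀ k u) (hc : IsDielectric c) (hx₀ : x₀ < 0)
    (hk : 0 < k) : ‖u 0‖ ≤ 1 / k := by
  have hin := hu.norm_incident hx₀ (fun x hx => hc.eq_one x (fun h => absurd h.1 (not_lt.2 hx)))
  have hout := hu.outgoing_right hx₀ (fun x hx => hc.eq_one x (fun h => absurd h.2 (not_lt.2 hx)))
  have hflux := eq_of_hasDerivAt_zero (convex_Ioi x₀)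
    (fun y hy => hu.hasDerivAt_flux (ne_of_gt hy)) (mem_Ioi.2 hx₀)
    (mem_Ioi.2 (hx₀.trans one_pos))
  have h0 := norm_sq_add_I_mul (deriv u 0) (u 0) k
  have h1 := norm_sq_add_I_mul (deriv u 1) (u 1) k
  rw [hout, norm_zero] at h1
  rw [hflux] at h0
  have hle : ‖deriv u 0 + Complex.I * k * u 0‖ ≤ 1 := by
    rw [hin] at h0
    nlinarith [norm_nonneg (deriv u 0 + Complex.I * k * u 0),
      sq_nonneg ‖deriv u 1 - Complex.I * k * u 1‖]
  have hu0 : 2 * k * ‖u 0‖ ≤ 2 := by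
    calc 2 * k * ‖u 0‖ = ‖2 * Complex.I * k * u 0‖ := by simp [abs_of_pos hk]
      _ = ‖(deriv u 0 + Complex.I * k * u 0) - (deriv u 0 - Complex.I * k * u 0)‖ := by
        congr 1; ring
      _ ≤ _ := norm_sub_le _ _
      _ ≤ 2 := by rw [hin]; linarith
  rw [le_div_iff₀ hk]; linarith

end IsHelmholtzSolution

lemma norm_u₀ (x₀ x : ℝ) {k : ℝ} (hk : 0 < k) : ‖u₀ x₀ x k‖ = 1 / (2 * k) := by
  have h := IsHelmholtzSolution.norm_exp_I_mul Complex.I (Or.inl rfl) k |x - x₀|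
  rw [u₀, norm_div, h]
  simp [abs_of_pos hk]

/-- The noiseless data satisfy `|g₀*| ≤ 2`. -/
lemma norm_wave_zero_le {c : ℝ → ℝ} {x₀ k : ℝ} {u : ℝ → ℝ → ℂ} (hc : IsDielectric c)
    (hx₀ : x₀ < 0) (hk : 0 < k) (hu : IsHelmholtzSolution c x₀ k (fun x => u x k)) :
    ‖wave x₀ u 0 k‖ ≤ 2 := by
  have h := hu.norm_zero_le hc hx₀ hk
  rw [wave, norm_div, norm_u₀ x₀ 0 hk, div_le_iff₀ (by positivity)]
  calc ‖u 0 k‖ ≤ 1 / k := h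
    _ = 2 * (1 / (2 * k)) := by field_simp

/-! ### Bounds for the measured data -/

namespace IsData

variable {k₁ k₂ : ℝ} {g₀ ℓ : ℝ → ℂ}

lemma ne_zero (hd : IsData k₁ k₂ g₀ ℓ) {k : ℝ} (hk : k ∈ Icc k₁ k₂) : g₀ k ≠ 0 := by
  rw [← hd.exp_log k hk]; exact Complex.exp_ne_zero _

lemma hasDerivWithinAt (hd : IsData k₁ k₂ g₀ ℓ) {k : ℝ} (hk : k ∈ Icc k₁ k₂) :
    HasDerivWithinAt g₀ (derivWithin g₀ (Icc k₁ k₂) k) (Icc k₁ k₂) k :=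
  (hd.contDiffOn.differentiableOn (by norm_num) k hk).hasDerivWithinAt

/-- Near `k`, the given branch of the logarithm is `ℓ k` plus the principal branch of
`log (g₀ / g₀ k)`; hence it is differentiable. -/
lemma hasDerivWithinAt_log (hd : IsData k₁ k₂ g₀ ℓ) {k : ℝ} (hk : k ∈ Icc k₁ k₂) :
    HasDerivWithinAt ℓ (derivWithin g₀ (Icc k₁ k₂) k / g₀ k) (Icc k₁ k₂) k := by
  have h0 := hd.ne_zero hk
  have h1 : HasDerivWithinAt (fun s => ℓ k + Complex.log (g₀ s / g₀ k))
      (derivWithin g₀ (Icc k₁ k₂) k / g₀ k) (Icc k₁ k₂) k := by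
    have h := (((hd.hasDerivWithinAt hk).div_const (g₀ k)).clog_real
      (by simp [div_self h0])).const_add (ℓ k)
    simpa [div_self h0] using h
  refine h1.congr_of_eventuallyEq ?_ (by simp [div_self h0])
  have hlim : Tendsto (fun s => (ℓ s - ℓ k).im) (𝓝[Icc k₁ k₂] k) (𝓝 0) := by
    have h := (hd.continuousOn_log k hk).tendsto.sub_const (ℓ k)
    rw [sub_self] at h
    simpa [Function.comp_def] using (Complex.continuous_im.tendsto _).comp h
  filter_upwards [self_mem_nhdsWithin, hlim.eventually (Ioo_mem_nhds
    (neg_lt_zero.2 Real.pi_pos) Real.pi_pos)] with s hs hs'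
  rw [← hd.exp_log s hs, ← hd.exp_log k hk, ← Complex.exp_sub,
    Complex.log_exp hs'.1 hs'.2.le]
  ring

lemma p₀_eq (hd : IsData k₁ k₂ g₀ ℓ) (hk₁ : 0 < k₁) (hlt : k₁ < k₂) {k : ℝ}
    (hk : k ∈ Icc k₁ k₂) :
    p₀ k₁ k₂ ℓ k = derivWithin g₀ (Icc k₁ k₂) k / g₀ k / (k : ℂ) ^ 2 - 2 * ℓ k / (k : ℂ) ^ 3 := by
  have hk0 : (k : ℂ) ≠ 0 := by exact_mod_cast (hk₁.trans_le hk.1).ne'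
  have hid : HasDerivWithinAt (fun s : ℝ => (s : ℂ)) 1 (Icc k₁ k₂) k :=
    (Complex.ofRealCLM.hasDerivAt (x := k)).hasDerivWithinAt
  have h := ((hd.hasDerivWithinAt_log hk).div (hid.pow 2) (pow_ne_zero 2 hk0)).derivWithin
    (uniqueDiffOn_Icc hlt k hk)
  refine h.trans ?_
  simp only [Pi.pow_apply]
  field_simp
  ring

lemma p₁_eq (hd : IsData k₁ k₂ g₀ ℓ) (hk₁ : 0 < k₁) (hlt : k₁ < k₂) {k : ℝ}
    (hk : k ∈ Icc k₁ k₂) :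
    p₁ k₁ k₂ g₀ k = -(2 * Complex.I / (k : ℂ) ^ 2) * (1 - 1 / g₀ k)
      + 2 * Complex.I / k * (derivWithin g₀ (Icc k₁ k₂) k / g₀ k ^ 2) := by
  have hk0 : (k : ℂ) ≠ 0 := by exact_mod_cast (hk₁.trans_le hk.1).ne'
  have h0 := hd.ne_zero hk
  have hid : HasDerivWithinAt (fun s : ℝ => (s : ℂ)) 1 (Icc k₁ k₂) k :=
    (Complex.ofRealCLM.hasDerivAt (x := k)).hasDerivWithinAt
  have h := ((((hasDerivWithinAt_const k (Icc k₁ k₂) (2 * Complex.I)).div hid hk0)).mul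
    (((hasDerivWithinAt_const k (Icc k₁ k₂) (1 : ℂ)).div (hd.hasDerivWithinAt hk) h0).const_sub
      1)).derivWithin (uniqueDiffOn_Icc hlt k hk)
  refine h.trans ?_
  simp only [Pi.div_apply]
  field_simp
  ring

lemma continuousOn_derivWithin (hd : IsData k₁ k₂ g₀ ℓ) (hlt : k₁ < k₂) :
    ContinuousOn (derivWithin g₀ (Icc k₁ k₂)) (Icc k₁ k₂) :=
  hd.contDiffOn.continuousOn_derivWithin (uniqueDiffOn_Icc hlt) le_rfl

lemma continuousOn_p₀ (hd : IsData k₁ k₂ g₀ ℓ) (hk₁ : 0 < k₁) (hlt : k₁ < k₂) :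
    ContinuousOn (p₀ k₁ k₂ ℓ) (Icc k₁ k₂) := by
  have hk0 : ∀ k ∈ Icc k₁ k₂, (k : ℂ) ≠ 0 := fun k hk => by
    exact_mod_cast (hk₁.trans_le hk.1).ne'
  have hid : ContinuousOn (fun k : ℝ => (k : ℂ)) (Icc k₁ k₂) :=
    Complex.continuous_ofReal.continuousOn
  refine ContinuousOn.congr ?_ fun k hk => hd.p₀_eq hk₁ hlt hk
  exact ((((hd.continuousOn_derivWithin hlt).div hd.contDiffOn.continuousOn
    (fun k hk => hd.ne_zero hk)).div (hid.pow 2) (fun k hk => pow_ne_zero 2 (hk0 k hk))).sub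
    ((continuousOn_const.mul hd.continuousOn_log).div (hid.pow 3)
      (fun k hk => pow_ne_zero 3 (hk0 k hk))))

lemma continuousOn_p₁ (hd : IsData k₁ k₂ g₀ ℓ) (hk₁ : 0 < k₁) (hlt : k₁ < k₂) :
    ContinuousOn (p₁ k₁ k₂ g₀) (Icc k₁ k₂) := by
  have hk0 : ∀ k ∈ Icc k₁ k₂, (k : ℂ) ≠ 0 := fun k hk => by
    exact_mod_cast (hk₁.trans_le hk.1).ne'
  have hid : ContinuousOn (fun k : ℝ => (k : ℂ)) (Icc k₁ k₂) :=
    Complex.continuous_ofReal.continuousOn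
  have hg := hd.contDiffOn.continuousOn
  refine ContinuousOn.congr ?_ fun k hk => hd.p₁_eq hk₁ hlt hk
  exact ((continuousOn_const.div (hid.pow 2) (fun k hk => pow_ne_zero 2 (hk0 k hk))).neg.mul
    (continuousOn_const.sub (continuousOn_const.div hg (fun k hk => hd.ne_zero hk)))).add
    ((continuousOn_const.div hid hk0).mul ((hd.continuousOn_derivWithin hlt).div (hg.pow 2)
      (fun k hk => pow_ne_zero 2 (hd.ne_zero hk))))

/-- `(log g₀)'` is a polynomial in `g₀` and `p₁`, so it is bounded by the bounds of those. -/
lemma norm_logDeriv_le (hd : IsData k₁ k₂ g₀ ℓ) (hk₁ : 0 < k₁) (hlt : k₁ < k₂) {M : ℝ} {k : ℝ}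
    (hk : k ∈ Icc k₁ k₂) (hg : ‖g₀ k‖ ≤ 3) (hp : ‖p₁ k₁ k₂ g₀ k‖ ≤ M) :
    ‖derivWithin g₀ (Icc k₁ k₂) k / g₀ k‖ ≤ k₂ / 2 * (3 * M + 2 / k₁ ^ 2 * 4) := by
  have hkpos := hk₁.trans_le hk.1
  have hk0 : (k : ℂ) ≠ 0 := by exact_mod_cast hkpos.ne'
  have h0 := hd.ne_zero hk
  have hM : 0 ≤ M := (norm_nonneg _).trans hp
  have h : derivWithin g₀ (Icc k₁ k₂) k / g₀ k
      = k / (2 * Complex.I) * (g₀ k * p₁ k₁ k₂ g₀ k + 2 * Complex.I / k ^ 2 * (g₀ k - 1)) := by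
    rw [hd.p₁_eq hk₁ hlt hk]
    field_simp
    ring
  have hn1 : ‖(k : ℂ) / (2 * Complex.I)‖ ≤ k₂ / 2 := by
    simpa [abs_of_pos hkpos] using (div_le_div_of_nonneg_right hk.2 (by norm_num : (0:ℝ) ≤ 2))
  have hn2 : ‖2 * Complex.I / (k : ℂ) ^ 2‖ ≤ 2 / k₁ ^ 2 := by
    have : 2 / k ^ 2 ≤ 2 / k₁ ^ 2 := by gcongr; exact hk.1
    simpa [abs_of_pos hkpos] using this
  have hn3 : ‖g₀ k - 1‖ ≤ 4 := (norm_sub_le _ _).trans (by rw [norm_one]; linarith)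
  rw [h, norm_mul]
  refine mul_le_mul hn1 ((norm_add_le _ _).trans ?_) (norm_nonneg _)
    (by linarith [hk₁.trans hlt])
  rw [norm_mul, norm_mul]
  gcongr

end IsData

/-- A bound for `log g₀` on `[k₁, k₂]` in terms of bounds `M` for `p₁` and `ρ` for
`k₂ V*(0) = r*(0)`. -/
def logBound (k₁ k₂ M ρ : ℝ) : ℝ :=
  k₂ * ρ + 1 + k₂ / 2 * (3 * M + 2 / k₁ ^ 2 * 4) * (k₂ - k₁)

lemma IsData.norm_log_le {k₁ k₂ M ρ : ℝ} {g₀ ℓ : ℝ → ℂ} (hd : IsData k₁ k₂ g₀ ℓ) (hk₁ : 0 < k₁)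
    (hlt : k₁ < k₂) (hg : ∀ k ∈ Icc k₁ k₂, ‖g₀ k‖ ≤ 3)
    (hp : ∀ k ∈ Icc k₁ k₂, ‖p₁ k₁ k₂ g₀ k‖ ≤ M) (hρ : ‖ℓ k₂‖ ≤ k₂ * ρ + 1) {k : ℝ}
    (hk : k ∈ Icc k₁ k₂) : ‖ℓ k‖ ≤ logBound k₁ k₂ M ρ := by
  have hr := right_mem_Icc.2 hlt.le
  have hM : 0 ≤ M := (norm_nonneg _).trans (hp _ hr)
  have h := (convex_Icc k₁ k₂).norm_image_sub_le_of_norm_hasDerivWithin_le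
    (fun x hx => hd.hasDerivWithinAt_log hx)
    (fun x hx => hd.norm_logDeriv_le hk₁ hlt hx (hg x hx) (hp x hx)) hr hk
  have h2 : ‖k - k₂‖ ≤ k₂ - k₁ := by
    rw [Real.norm_eq_abs, abs_sub_comm, abs_of_nonneg (by linarith [hk.2])]
    linarith [hk.1]
  have h3 := norm_add_le (ℓ k₂) (ℓ k - ℓ k₂)
  rw [add_sub_cancel] at h3
  have hk₂ := hk₁.trans hlt
  have h4 : k₂ / 2 * (3 * M + 2 / k₁ ^ 2 * 4) * ‖k - k₂‖
      ≤ k₂ / 2 * (3 * M + 2 / k₁ ^ 2 * 4) * (k₂ - k₁) := by gcongr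
  rw [logBound]
  linarith

lemma IsData.norm_p₀_le {k₁ k₂ M B : ℝ} {g₀ ℓ : ℝ → ℂ} (hd : IsData k₁ k₂ g₀ ℓ) (hk₁ : 0 < k₁)
    (hlt : k₁ < k₂) {k : ℝ} (hk : k ∈ Icc k₁ k₂) (hg : ‖g₀ k‖ ≤ 3)
    (hp : ‖p₁ k₁ k₂ g₀ k‖ ≤ M) (hB : ‖ℓ k‖ ≤ B) :
    ‖p₀ k₁ k₂ ℓ k‖ ≤ k₂ / 2 * (3 * M + 2 / k₁ ^ 2 * 4) / k₁ ^ 2 + 2 * B / k₁ ^ 3 := by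
  have hkpos := hk₁.trans_le hk.1
  have hM : 0 ≤ M := (norm_nonneg _).trans hp
  have hB0 : 0 ≤ B := (norm_nonneg _).trans hB
  have hk₂ := hk₁.trans hlt
  have h1 : k₁ ^ 2 ≤ k ^ 2 := by gcongr; exact hk.1
  have h2 : k₁ ^ 3 ≤ k ^ 3 := by gcongr; exact hk.1
  rw [hd.p₀_eq hk₁ hlt hk]
  refine (norm_sub_le _ _).trans (add_le_add ?_ ?_)
  · rw [norm_div _ ((k : ℂ) ^ 2), norm_pow, Complex.norm_real, Real.norm_of_nonneg hkpos.le]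
    exact div_le_div₀ (by positivity) (hd.norm_logDeriv_le hk₁ hlt hk hg hp) (by positivity) h1
  · rw [norm_div, norm_mul, norm_pow, Complex.norm_real, Real.norm_of_nonneg hkpos.le,
      Complex.norm_two]
    exact div_le_div₀ (by positivity) (by linarith) (by positivity) h2

/-! ### Bound for the approximate tail function -/

/-- The quadratic polynomial with value `a` and derivative `b` at `0` and derivative `0` at `1`,
with its derivatives. -/
def comparisonTail (a b : ℂ) : ℕ → ℝ → ℂ
  | 0 => fun x => a + b * (x - x ^ 2 / 2)
  | 1 => fun x => b * (1 - x)
  | 2 => fun _ => -b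
  | _ => fun _ => 0

lemma isSobolev_comparisonTail (a b : ℂ) : IsSobolev 3 (comparisonTail a b) where
  memLp := by
    have : comparisonTail a b 3 = fun _ => 0 := rfl
    rw [this]
    exact MemLp.zero
  primitive := by
    have hid : ∀ x : ℝ, HasDerivAt (fun y : ℝ => (y : ℂ)) 1 x := fun x =>
      Complex.ofRealCLM.hasDerivAt
    intro j hj x _
    interval_cases j
    · have h : ∀ t ∈ uIcc (0 : ℝ) x, HasDerivAt (comparisonTail a b 0) (comparisonTail a b 1 t) t :=
        fun t _ => by
          refine ((((hid t).sub (((hid t).pow 2).div_const 2)).const_mul b).const_add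
            a).congr_deriv ?_
          simp [comparisonTail]
      rw [intervalIntegral.integral_eq_sub_of_hasDerivAt h
        (Continuous.intervalIntegrable (by unfold comparisonTail; fun_prop) _ _)]
      ring
    · have h : ∀ t ∈ uIcc (0 : ℝ) x, HasDerivAt (comparisonTail a b 1) (comparisonTail a b 2 t) t :=
        fun t _ => by
          refine (((hid t).const_sub 1).const_mul b).congr_deriv ?_
          simp [comparisonTail]
      rw [intervalIntegral.integral_eq_sub_of_hasDerivAt h
        (Continuous.intervalIntegrable (by unfold comparisonTail; fun_prop) _ _)]
      ring
    · simp [comparisonTail]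

lemma integral_norm_sq_le_of_norm_le {f : ℝ → ℂ} {B : ℝ} (h : ∀ x ∈ Icc (0 : ℝ) 1, ‖f x‖ ≤ B) :
    ∫ x in (0 : ℝ)..1, ‖f x‖ ^ 2 ≤ B ^ 2 := by
  have h2 := intervalIntegral.norm_integral_le_of_norm_le_const (a := (0 : ℝ)) (b := 1)
    (f := fun x => ‖f x‖ ^ 2) (C := B ^ 2) (fun x hx => by
      rw [uIoc_of_le zero_le_one] at hx
      rw [norm_pow, norm_norm]
      exact pow_le_pow_left₀ (norm_nonneg _) (h x ⟨hx.1.le, hx.2⟩) 2)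
  simpa using (Real.le_norm_self _).trans h2

lemma qrmFunctional_comparisonTail_le {α : ℝ} (hα : α ≤ 1) (a b : ℂ) :
    qrmFunctional α (comparisonTail a b) ≤ 4 * (‖a‖ + ‖b‖) ^ 2 := by
  have hI : ∀ x : ℝ, x ∈ Icc (0 : ℝ) 1 → ‖(x : ℂ) - x ^ 2 / 2‖ ≤ 1 ∧ ‖(1 : ℂ) - x‖ ≤ 1 := by
    intro x hx
    have h1 : (x : ℂ) - x ^ 2 / 2 = ((x - x ^ 2 / 2 : ℝ) : ℂ) := by push_cast; ring
    have h2 : (1 : ℂ) - x = ((1 - x : ℝ) : ℂ) := by push_cast; ring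
    rw [h1, h2, Complex.norm_real, Complex.norm_real, Real.norm_eq_abs, Real.norm_eq_abs,
      abs_le, abs_le]
    refine ⟨⟨?_, ?_⟩, ?_, ?_⟩ <;> nlinarith [hx.1, hx.2]
  have hB : ∀ j, ∀ x ∈ Icc (0 : ℝ) 1, ‖comparisonTail a b j x‖ ≤ ‖a‖ + ‖b‖ := by
    intro j x hx
    match j with
    | 0 =>
      refine (norm_add_le _ _).trans (add_le_add le_rfl ?_)
      rw [norm_mul]
      exact mul_le_of_le_one_right (norm_nonneg _) (hI x hx).1
    | 1 =>
      change ‖b * (1 - (x : ℂ))‖ ≤ _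
      rw [norm_mul]
      exact (mul_le_of_le_one_right (norm_nonneg _) (hI x hx).2).trans
        (le_add_of_nonneg_left (norm_nonneg _))
    | 2 =>
      change ‖-b‖ ≤ _
      rw [norm_neg]
      exact le_add_of_nonneg_left (norm_nonneg _)
    | (n + 3) =>
      change ‖(0 : ℂ)‖ ≤ _
      rw [norm_zero]
      positivity
  have h := fun j => integral_norm_sq_le_of_norm_le (hB j)
  have hs : ∑ j ∈ Finset.range 4, ∫ x in (0 : ℝ)..1, ‖comparisonTail a b j x‖ ^ 2
      ≤ 4 * (‖a‖ + ‖b‖) ^ 2 := by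
    refine (Finset.sum_le_sum fun j _ => h j).trans_eq ?_
    simp
  have hs' : α * ∑ j ∈ Finset.range 4, ∫ x in (0 : ℝ)..1, ‖comparisonTail a b j x‖ ^ 2
      ≤ 1 * (4 * (‖a‖ + ‖b‖) ^ 2) :=
    mul_le_mul hα hs (Finset.sum_nonneg fun j _ =>
      intervalIntegral.integral_nonneg zero_le_one fun x _ => by positivity) zero_le_one
  unfold qrmFunctional
  nlinarith [h 2]

lemma IsSobolev.continuousOn {D : ℕ → ℝ → ℂ} {n : ℕ} (hD : IsSobolev (n + 1) D) {j : ℕ}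
    (hj : j ≤ n) : ContinuousOn (D j) (Icc 0 1) := by
  have key : ∀ j < n + 1, IntegrableOn (D (j + 1)) (Icc 0 1) → ContinuousOn (D j) (Icc 0 1) := by
    intro j hj h
    refine ContinuousOn.congr ?_ (hD.primitive j hj)
    refine continuousOn_const.add ?_
    have := intervalIntegral.continuousOn_primitive_interval (μ := volume) (f := D (j + 1))
      (a := 0) (b := 1) (by rwa [uIcc_of_le zero_le_one])
    rwa [uIcc_of_le zero_le_one] at this
  obtain ⟨d, rfl⟩ := Nat.exists_eq_add_of_le hj
  clear hj
  induction d generalizing j with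
  | zero =>
    refine key j (by lia) ?_
    rw [integrableOn_Icc_iff_integrableOn_Ioo]
    exact hD.memLp.integrable (by norm_num)
  | succ d ih =>
    refine key j (by lia) (ContinuousOn.integrableOn_Icc ?_)
    have e : j + 1 + d = j + (d + 1) := by ring
    refine ih (j := j + 1) ?_ ?_
    · rwa [e]
    · rwa [e]

/-- The minimizer is compared with `comparisonTail`; this bounds `V''` in `L²(0, 1)` and with it
`V' = V'(0) + ∫ V''`, uniformly in the regularization parameter. -/
lemma IsTailMinimizer.norm_deriv_le {α k₂ A : ℝ} {g₀ ℓ : ℝ → ℂ} {V : ℕ → ℝ → ℂ}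
    (hV : IsTailMinimizer α k₂ g₀ ℓ V) (hα₀ : 0 ≤ α) (hα : α ≤ 1)
    (hA : ‖ℓ k₂ / (k₂ : ℂ) ^ 2‖ + ‖2 * Complex.I / k₂ * (1 - 1 / g₀ k₂)‖ ≤ A) {x : ℝ}
    (hx : x ∈ Icc (0 : ℝ) 1) : ‖V 1 x‖ ≤ A + (1 + 8 * A ^ 2) := by
  obtain ⟨⟨hS, -, hb, -⟩, hmin⟩ := hV
  set a := ℓ k₂ / (k₂ : ℂ) ^ 2
  set b := 2 * Complex.I / k₂ * (1 - 1 / g₀ k₂)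
  have h1 := (hmin (comparisonTail a b) ⟨isSobolev_comparisonTail a b, by simp [comparisonTail, a],
    by simp [comparisonTail, b], by simp [comparisonTail]⟩).trans
    (qrmFunctional_comparisonTail_le hα a b)
  have h2 : ∫ t in (0 : ℝ)..1, ‖V 2 t‖ ^ 2 ≤ 8 * A ^ 2 := by
    have h3 : 0 ≤ α * ∑ j ∈ Finset.range 4, ∫ x in (0 : ℝ)..1, ‖V j x‖ ^ 2 :=
      mul_nonneg hα₀ (Finset.sum_nonneg fun j _ =>
        intervalIntegral.integral_nonneg zero_le_one fun x _ => by positivity)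
    have h4 : (‖a‖ + ‖b‖) ^ 2 ≤ A ^ 2 := pow_le_pow_left₀ (by positivity) hA 2
    unfold qrmFunctional at h1
    linarith
  have hc : ContinuousOn (V 2) (Icc 0 1) := hS.continuousOn (n := 2) le_rfl
  have hc' : IntervalIntegrable (fun t => 1 + ‖V 2 t‖ ^ 2) volume 0 1 := by
    refine ContinuousOn.intervalIntegrable ?_
    rw [uIcc_of_le zero_le_one]
    exact continuousOn_const.add (hc.norm.pow 2)
  have hsq : IntervalIntegrable (fun t => ‖V 2 t‖ ^ 2) volume 0 1 := by
    refine ContinuousOn.intervalIntegrable ?_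
    rw [uIcc_of_le zero_le_one]
    exact hc.norm.pow 2
  -- The crude bound `‖V''‖ ≤ 1 + ‖V''‖²` replaces the Cauchy-Schwarz inequality.
  have h5 : ‖∫ t in (0 : ℝ)..x, V 2 t‖ ≤ 1 + 8 * A ^ 2 := by
    calc ‖∫ t in (0 : ℝ)..x, V 2 t‖ ≤ ∫ t in (0 : ℝ)..x, (1 + ‖V 2 t‖ ^ 2) :=
          intervalIntegral.norm_integral_le_of_norm_le hx.1
            (ae_of_all _ fun t _ => by nlinarith [sq_nonneg (‖V 2 t‖ - 1)])
            (hc'.mono_set (by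
              rw [uIcc_of_le hx.1, uIcc_of_le zero_le_one]; exact Icc_subset_Icc_right hx.2))
      _ ≤ ∫ t in (0 : ℝ)..1, (1 + ‖V 2 t‖ ^ 2) :=
          intervalIntegral.integral_mono_interval le_rfl hx.1 hx.2
            (ae_of_all _ fun t => by simp only [Pi.zero_apply]; positivity) hc'
      _ = 1 + ∫ t in (0 : ℝ)..1, ‖V 2 t‖ ^ 2 := by
          rw [intervalIntegral.integral_add (by simp) hsq]; simp
      _ ≤ _ := by linarith
  rw [hS.primitive 1 (by norm_num) x hx, hb]
  refine (norm_add_le _ _).trans (add_le_add ?_ h5)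
  linarith [norm_nonneg a]

/-- All the data that enter the cost functional are bounded by a constant that depends on
`k₁, k₂`, the bound for `p₁` and the value of `r*` only. -/
lemma exists_data_bound (x₀ k₁ k₂ M : ℝ) (r : ℝ → ℂ) (hx₀ : x₀ < 0) (hk₁ : 0 < k₁)
    (hk : k₁ < k₂) :
    ∃ K : ℝ, 0 ≤ K ∧
      ∀ (c : ℝ → ℝ) (u ψ : ℝ → ℝ → ℂ) (δ : ℝ) (g₀ ℓ : ℝ → ℂ) (V : ℕ → ℝ → ℂ),
        IsDielectric c →
        (∀ k : ℝ, 0 < k → IsHelmholtzSolution c x₀ k (fun x => u x k)) →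
        (∀ x ∈ Icc (0 : ℝ) 1, ψ x k₂ / (k₂ : ℂ) ^ 2 = r x / (k₂ : ℂ)) →
        0 < δ → δ ≤ 1 →
        IsData k₁ k₂ g₀ ℓ →
        NoiseLevel k₁ k₂ δ g₀ ℓ (wave x₀ u 0) (ψ 0) →
        (∀ k ∈ Icc k₁ k₂, ‖p₁ k₁ k₂ g₀ k‖ ≤ M) →
        IsTailMinimizer (δ ^ 2) k₂ g₀ ℓ V →
        (∀ k ∈ Icc k₁ k₂, ‖p₀ k₁ k₂ ℓ k‖ ≤ K ∧ ‖p₁ k₁ k₂ g₀ k‖ ≤ K) ∧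
          ∀ x ∈ Icc (0 : ℝ) 1, ‖V 1 x‖ ≤ K := by
  set B := logBound k₁ k₂ M ‖r 0‖ with hBdef
  set P := k₂ / 2 * (3 * M + 2 / k₁ ^ 2 * 4) / k₁ ^ 2 + 2 * B / k₁ ^ 3 with hP
  set A := B / k₂ ^ 2 + 2 / k₂ * (1 + Real.exp B) with hA
  refine ⟨max 0 (max P (max M (A + (1 + 8 * A ^ 2)))), le_max_left _ _, ?_⟩
  intro c u ψ δ g₀ ℓ V hc hu hr hδ hδ1 hd hn hM hV
  have hk₂ := hk₁.trans hk
  have hk₂' : (k₂ : ℂ) ≠ 0 := by exact_mod_cast hk₂.ne'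
  have hmem := right_mem_Icc.2 hk.le
  -- `|g₀*| ≤ 2` and the noise level is at most `1`.
  have hg : ∀ k ∈ Icc k₁ k₂, ‖g₀ k‖ ≤ 3 := fun k hk' => by
    have hkpos := hk₁.trans_le hk'.1
    have h1 := norm_wave_zero_le hc hx₀ hkpos (hu k hkpos)
    have h2 := norm_add_le (wave x₀ u 0 k) (g₀ k - wave x₀ u 0 k)
    rw [add_sub_cancel] at h2
    linarith [(hn k hk').2.1]
  have hℓ₂ : ‖ℓ k₂‖ ≤ k₂ * ‖r 0‖ + 1 := by
    have h0 : ψ 0 k₂ = k₂ * r 0 := by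
      have := hr 0 (by simp)
      field_simp at this
      linear_combination this
    have h2 := norm_add_le (ψ 0 k₂) (ℓ k₂ - ψ 0 k₂)
    rw [add_sub_cancel] at h2
    have h3 : ‖ψ 0 k₂‖ = k₂ * ‖r 0‖ := by
      rw [h0, norm_mul, Complex.norm_real, Real.norm_of_nonneg hk₂.le]
    linarith [(hn k₂ hmem).1]
  have hℓ : ∀ k ∈ Icc k₁ k₂, ‖ℓ k‖ ≤ B := fun k hk' => hd.norm_log_le hk₁ hk hg hM hℓ₂ hk'
  refine ⟨fun k hk' => ⟨?_, ?_⟩, fun x hx => ?_⟩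
  · exact (hd.norm_p₀_le hk₁ hk hk' (hg k hk') (hM k hk') (hℓ k hk')).trans
      ((le_max_left _ _).trans (le_max_right _ _))
  · exact (hM k hk').trans
      ((le_max_left _ _).trans ((le_max_right _ _).trans (le_max_right _ _)))
  · refine (hV.norm_deriv_le (A := A) (by positivity) (pow_le_one₀ hδ.le hδ1) ?_ hx).trans
      ((le_max_right _ _).trans ((le_max_right _ _).trans (le_max_right _ _)))
    refine add_le_add ?_ ?_
    · rw [norm_div, norm_pow, Complex.norm_real, Real.norm_of_nonneg hk₂.le]
      gcongr
      exact hℓ k₂ hmem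
    · rw [norm_mul]
      have h1 : ‖2 * Complex.I / (k₂ : ℂ)‖ = 2 / k₂ := by simp [abs_of_pos hk₂]
      rw [h1]
      refine mul_le_mul_of_nonneg_left ((norm_sub_le _ _).trans ?_) (by positivity)
      rw [norm_one, ← hd.exp_log k₂ hmem, one_div, ← Complex.exp_neg]
      gcongr
      refine (Complex.norm_exp_le_exp_norm _).trans (Real.exp_le_exp.2 ?_)
      rw [norm_neg]
      exact hℓ k₂ hmem

/-! ### Squared norms of quadratic maps -/

section QuadraticMap

variable {X Y Z : Type*} [NormedAddCommGroup X] [InnerProductSpace ℝ X] [CompleteSpace X]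
  [NormedAddCommGroup Y] [InnerProductSpace ℝ Y] [NormedAddCommGroup Z] [NormedSpace ℝ Z]

/-- The Lipschitz constant depends on the fixed operators `β`, `b`, `a` and on bounds for `p` and
`z₀`, but neither on the affine shift `z₀` nor on the contraction `W` itself. -/
theorem exists_lipschitz_gradient_norm_sq (β : Z →L[ℝ] Y) (b : Z →L[ℝ] Z →L[ℝ] Y) (a : X →L[ℝ] Z)
    {R K : ℝ} (hR : 0 ≤ R) (hK : 0 ≤ K) :
    ∃ C : ℝ, 0 < C ∧ ∀ (z₀ : Z) (W : Y →L[ℝ] Y) (s : ℝ), ‖z₀‖ ≤ K → ‖W‖ ≤ 1 → 0 ≤ s →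
      ∀ F : X → ℝ, (∀ p, F p = s * ‖W (β (a p + z₀) + b (a p + z₀) (a p + z₀))‖ ^ 2) →
        Differentiable ℝ F ∧ ∀ p q, ‖p‖ ≤ R → ‖q‖ ≤ R →
          ‖gradient F p - gradient F q‖ ≤ C * s * ‖p - q‖ := by
  set ρ := ‖a‖ * R + K with hρ
  have hρ0 : 0 ≤ ρ := by positivity
  set c₀ := ‖β‖ * ρ + ‖b‖ * ρ * ρ with hc₀
  set c₁ := ‖β‖ + ‖b‖ * ρ + ‖b‖ * ρ with hc₁
  have hc₀0 : 0 ≤ c₀ := by positivity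
  have hc₁0 : 0 ≤ c₁ := by positivity
  -- `c₀` bounds the quadratic map on the ball of radius `ρ`, and `c₁` its derivative.
  refine ⟨2 * (c₁ * c₁ + c₀ * (2 * ‖b‖)) * ‖a‖ * ‖a‖ + 1, by positivity, ?_⟩
  intro z₀ W s hz₀ hW hs F hF
  obtain rfl : F = fun p => s * ‖W (β (a p + z₀) + b (a p + z₀) (a p + z₀))‖ ^ 2 := funext hF
  set N : Z → Y := fun z => β z + b z z with hN
  set N' : Z → Z →L[ℝ] Y := fun z => β + b z + b.flip z with hN'
  have hNd : ∀ z, HasFDerivAt N (N' z) z := fun z => by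
    refine (β.hasFDerivAt.add (b.hasFDerivAt.clm_apply (hasFDerivAt_id z))).congr_fderiv ?_
    ext w
    simp [hN', add_assoc]
  have hΨ : ∀ p, HasFDerivAt (fun p => W (N (a p + z₀)))
      (W ∘L (N' (a p + z₀) ∘L a)) p := fun p => by
    have h : HasFDerivAt (fun p => N (a p + z₀)) (N' (a p + z₀) ∘L a) p :=
      HasFDerivAt.comp (g := N) (f := fun p => a p + z₀) p (hNd (a p + z₀))
        (a.hasFDerivAt.add_const z₀)
    exact W.hasFDerivAt.comp p h
  have hF' : ∀ p, HasFDerivAt (fun p => s * ‖W (N (a p + z₀))‖ ^ 2)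
      (s • (2 • (innerSL ℝ (W (N (a p + z₀)))).comp (W ∘L (N' (a p + z₀) ∘L a)))) p := fun p =>
    ((hΨ p).norm_sq).const_mul s
  refine ⟨fun p => (hF' p).differentiableAt, fun p q hp hq => ?_⟩
  have hzρ : ∀ p, ‖p‖ ≤ R → ‖a p + z₀‖ ≤ ρ := fun p hp =>
    (norm_add_le _ _).trans (add_le_add ((a.le_opNorm p).trans (by gcongr)) hz₀)
  set z := a p + z₀ with hz
  set w := a q + z₀ with hw
  have hzn : ‖z‖ ≤ ρ := hzρ p hp
  have hwn : ‖w‖ ≤ ρ := hzρ q hq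
  have hzw : ‖z - w‖ ≤ ‖a‖ * ‖p - q‖ := by
    have : z - w = a (p - q) := by rw [hz, hw, map_sub]; abel
    rw [this]
    exact a.le_opNorm _
  have hWle : ∀ y, ‖W y‖ ≤ ‖y‖ := fun y => by
    simpa using W.le_of_opNorm_le hW y
  have hNw : ‖N w‖ ≤ c₀ := by
    refine (norm_add_le _ _).trans (add_le_add ((β.le_opNorm w).trans (by gcongr)) ?_)
    exact (b.le_opNorm₂ w w).trans (by gcongr)
  have hN'z : ‖N' z‖ ≤ c₁ := by
    refine (norm_add₃_le).trans (add_le_add (add_le_add le_rfl ?_) ?_)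
    · exact (b.le_opNorm z).trans (by gcongr)
    · exact (b.flip.le_opNorm z).trans (by rw [b.opNorm_flip]; gcongr)
  have hNzw : ‖N z - N w‖ ≤ c₁ * ‖z - w‖ := by
    have : N z - N w = β (z - w) + b z (z - w) + b (z - w) w := by
      simp only [hN, map_sub, sub_apply]
      abel
    rw [this, hc₁, add_mul, add_mul]
    refine (norm_add₃_le).trans (add_le_add (add_le_add (β.le_opNorm _) ?_) ?_)
    · exact (b.le_opNorm₂ z _).trans (by gcongr)
    · refine (b.le_opNorm₂ _ w).trans ?_
      rw [mul_right_comm]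
      gcongr
  have hN'zw : ‖N' z - N' w‖ ≤ 2 * ‖b‖ * ‖z - w‖ := by
    have : N' z - N' w = b (z - w) + b.flip (z - w) := by
      simp only [hN', map_sub]
      abel
    rw [this, mul_assoc, two_mul]
    refine (norm_add_le _ _).trans (add_le_add (b.le_opNorm _) ?_)
    simpa only [b.opNorm_flip] using b.flip.le_opNorm (z - w)
  have hG : ∀ p, gradient (fun p => s * ‖W (N (a p + z₀))‖ ^ 2) p =
      (InnerProductSpace.toDual ℝ X).symm
      (s • (2 • (innerSL ℝ (W (N (a p + z₀)))).comp (W ∘L (N' (a p + z₀) ∘L a)))) := fun p => by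
    rw [gradient, (hF' p).fderiv]
  change ‖gradient (fun p => s * ‖W (N (a p + z₀))‖ ^ 2) p
    - gradient (fun p => s * ‖W (N (a p + z₀))‖ ^ 2) q‖ ≤ _
  rw [hG, hG, ← map_sub, LinearIsometryEquiv.norm_map]
  refine ContinuousLinearMap.opNorm_le_bound _ (by positivity) fun h => ?_
  have key : |inner ℝ (W (N z)) (W (N' z (a h))) - inner ℝ (W (N w)) (W (N' w (a h)))|
      ≤ (c₁ * c₁ + c₀ * (2 * ‖b‖)) * ‖a‖ * ‖a‖ * ‖p - q‖ * ‖h‖ := by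
    have e : inner ℝ (W (N z)) (W (N' z (a h))) - inner ℝ (W (N w)) (W (N' w (a h)))
        = inner ℝ (W (N z - N w)) (W (N' z (a h)))
          + inner ℝ (W (N w)) (W ((N' z - N' w) (a h))) := by
      simp only [map_sub, inner_sub_left, inner_sub_right, sub_apply]
      ring
    rw [e]
    refine (abs_add_le _ _).trans ?_
    have h1 : |inner ℝ (W (N z - N w)) (W (N' z (a h)))|
        ≤ (c₁ * (‖a‖ * ‖p - q‖)) * (c₁ * (‖a‖ * ‖h‖)) := by
      refine (abs_real_inner_le_norm _ _).trans (mul_le_mul ?_ ?_ (norm_nonneg _) (by positivity))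
      · exact (hWle _).trans (hNzw.trans (by gcongr))
      · refine (hWle _).trans (((N' z).le_opNorm _).trans ?_)
        exact mul_le_mul hN'z (a.le_opNorm h) (norm_nonneg _) hc₁0
    have h2 : |inner ℝ (W (N w)) (W ((N' z - N' w) (a h)))|
        ≤ c₀ * ((2 * ‖b‖ * (‖a‖ * ‖p - q‖)) * (‖a‖ * ‖h‖)) := by
      refine (abs_real_inner_le_norm _ _).trans (mul_le_mul ?_ ?_ (norm_nonneg _) hc₀0)
      · exact (hWle _).trans hNw
      · refine (hWle _).trans (((N' z - N' w).le_opNorm _).trans ?_)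
        exact mul_le_mul (hN'zw.trans (by gcongr)) (a.le_opNorm h) (norm_nonneg _) (by positivity)
    refine (add_le_add h1 h2).trans_eq ?_
    ring
  have e : (s • (2 • (innerSL ℝ (W (N z))).comp (W ∘L (N' z ∘L a)))
      - s • (2 • (innerSL ℝ (W (N w))).comp (W ∘L (N' w ∘L a)))) h
      = s * 2 * (inner ℝ (W (N z)) (W (N' z (a h))) - inner ℝ (W (N w)) (W (N' w (a h)))) := by
    simp
    ring
  rw [e, Real.norm_eq_abs, abs_mul, abs_of_nonneg (by positivity)]
  refine (mul_le_mul_of_nonneg_left key (by positivity)).trans ?_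
  have : 0 ≤ s * ‖p - q‖ * ‖h‖ := by positivity
  linarith

end QuadraticMap

/-! ### Operators on `L²`-spaces of vector-valued functions -/

section VectorValued

variable {F : Type*} [NormedAddCommGroup F]

lemma norm_sq_eq_integral {α : Type*} {_ : MeasurableSpace α} {μ : Measure α}
    [InnerProductSpace ℝ F] (f : Lp F 2 μ) : ‖f‖ ^ 2 = ∫ x, ‖f x‖ ^ 2 ∂μ := by
  rw [← real_inner_self_eq_norm_sq, L2.inner_def]
  simp only [real_inner_self_eq_norm_sq]

lemma integral_norm_le_mul_norm {α : Type*} {_ : MeasurableSpace α} {μ : Measure α}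
    [IsFiniteMeasure μ] (f : Lp F 2 μ) :
    ∫ x, ‖f x‖ ∂μ ≤ (μ univ ^ (1 / (1 : ℝ≥0∞).toReal - 1 / (2 : ℝ≥0∞).toReal)).toReal * ‖f‖ := by
  have h := eLpNorm_le_eLpNorm_mul_rpow_measure_univ (p := 1) (q := 2) (by norm_num)
    (Lp.aestronglyMeasurable f)
  rw [integral_norm_eq_lintegral_enorm (Lp.aestronglyMeasurable f),
    ← eLpNorm_one_eq_lintegral_enorm, mul_comm, Lp.norm_def, ← ENNReal.toReal_mul]
  refine ENNReal.toReal_mono ?_ h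
  exact ENNReal.mul_ne_top (Lp.eLpNorm_ne_top f) (by norm_num)

lemma memLp_of_continuousOn {a b : ℝ} {f : ℝ → F} (hf : ContinuousOn f (Icc a b)) (q : ℝ≥0∞) :
    MemLp f q (volume.restrict (Ioo a b)) := by
  obtain ⟨C, hC⟩ := isCompact_Icc.exists_bound_of_continuousOn hf
  refine MemLp.of_bound ((hf.mono Ioo_subset_Icc_self).aestronglyMeasurable measurableSet_Ioo) C ?_
  filter_upwards [ae_restrict_mem measurableSet_Ioo] with x hx using hC x (Ioo_subset_Icc_self hx)

variable {k₁ k₂ : ℝ}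

lemma integrableOn_Icc_of_Lp (f : Lp F 2 (volume.restrict (Ioo k₁ k₂))) :
    IntegrableOn f (Icc k₁ k₂) := by
  rw [integrableOn_Icc_iff_integrableOn_Ioo]
  exact (Lp.memLp f).integrable (by norm_num)

lemma intervalIntegrable_of_Lp (f : Lp F 2 (volume.restrict (Ioo k₁ k₂))) {k : ℝ}
    (hk : k ∈ Ioo k₁ k₂) : IntervalIntegrable f volume k k₂ := by
  rw [intervalIntegrable_iff_integrableOn_Ioc_of_le hk.2.le]
  exact (integrableOn_Icc_of_Lp f).mono_set fun x hx => ⟨hk.1.le.trans hx.1.le, hx.2⟩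

variable [NormedSpace ℝ F]

lemma intervalIntegral_congr_ae_restrict {f g : ℝ → F} (h : f =ᵐ[volume.restrict (Ioo k₁ k₂)] g)
    {k : ℝ} (hk : k ∈ Ioo k₁ k₂) : ∫ τ in k..k₂, f τ = ∫ τ in k..k₂, g τ := by
  rw [intervalIntegral.integral_of_le hk.2.le, intervalIntegral.integral_of_le hk.2.le,
    integral_Ioc_eq_integral_Ioo, integral_Ioc_eq_integral_Ioo]
  exact integral_congr_ae (ae_mono (Measure.restrict_mono (Ioo_subset_Ioo_left hk.1.le) le_rfl) h)

lemma continuousOn_tailIntegral (hlt : k₁ < k₂) (f : Lp F 2 (volume.restrict (Ioo k₁ k₂))) :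
    ContinuousOn (fun k => ∫ τ in k..k₂, f τ) (Icc k₁ k₂) := by
  have := intervalIntegral.continuousOn_primitive_interval_left (μ := volume) (f := f)
    (a := k₁) (b := k₂) (by rw [uIcc_of_le hlt.le]; exact integrableOn_Icc_of_Lp f)
  rwa [uIcc_of_le hlt.le] at this

variable (F) in
/-- The operator `f ↦ ∫_k^{k₂} f(τ) dτ` from `L²((k₁, k₂); F)` to `L^∞((k₁, k₂); F)`. -/
def tailIntegral (hlt : k₁ < k₂) :
    Lp F 2 (volume.restrict (Ioo k₁ k₂)) →L[ℝ] Lp F ∞ (volume.restrict (Ioo k₁ k₂)) :=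
  LinearMap.mkContinuous
    { toFun := fun f => (memLp_of_continuousOn (continuousOn_tailIntegral hlt f) ∞).toLp _
      map_add' := fun f g => by
        rw [← MemLp.toLp_add]
        refine MemLp.toLp_congr _ _ ?_
        filter_upwards [ae_restrict_mem measurableSet_Ioo] with k hk
        rw [intervalIntegral_congr_ae_restrict (Lp.coeFn_add f g) hk]
        exact intervalIntegral.integral_add (intervalIntegrable_of_Lp f hk)
          (intervalIntegrable_of_Lp g hk)
      map_smul' := fun r f => by
        rw [RingHom.id_apply, ← MemLp.toLp_const_smul]
        refine MemLp.toLp_congr _ _ ?_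
        filter_upwards [ae_restrict_mem measurableSet_Ioo] with k hk
        rw [intervalIntegral_congr_ae_restrict (Lp.coeFn_smul r f) hk]
        exact intervalIntegral.integral_smul r _ }
    (((volume.restrict (Ioo k₁ k₂)) univ
      ^ (1 / (1 : ℝ≥0∞).toReal - 1 / (2 : ℝ≥0∞).toReal)).toReal) fun f => by
      have hb := Lp.norm_le_of_ae_bound (p := ∞)
        (f := (memLp_of_continuousOn (continuousOn_tailIntegral hlt f) ∞).toLp _)
        (C := ∫ τ in Ioo k₁ k₂, ‖f τ‖) (integral_nonneg fun _ => norm_nonneg _) (by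
          filter_upwards [MemLp.coeFn_toLp
            (memLp_of_continuousOn (continuousOn_tailIntegral hlt f) ∞),
            ae_restrict_mem measurableSet_Ioo] with k hk hk'
          rw [hk, intervalIntegral.integral_of_le hk'.2.le, integral_Ioc_eq_integral_Ioo]
          refine (norm_integral_le_integral_norm _).trans (setIntegral_mono_set ?_
            (ae_of_all _ fun _ => norm_nonneg _)
            (LE.le.eventuallyLE (Ioo_subset_Ioo_left hk'.1.le)))
          exact ((Lp.memLp f).integrable (by norm_num)).norm)
      simp only [ENNReal.toReal_top, inv_zero, Real.rpow_zero, one_mul] at hb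
      exact hb.trans (integral_norm_le_mul_norm f)

lemma coeFn_tailIntegral (hlt : k₁ < k₂) (f : Lp F 2 (volume.restrict (Ioo k₁ k₂))) :
    tailIntegral F hlt f =ᵐ[volume.restrict (Ioo k₁ k₂)] fun k => ∫ τ in k..k₂, f τ :=
  MemLp.coeFn_toLp (memLp_of_continuousOn (continuousOn_tailIntegral hlt f) ∞)

end VectorValued

/-! ### Operators in the space variable -/

/-- Complex valued continuous functions on `[0, 1]`. -/
abbrev C01 : Type := C(Icc (0 : ℝ) 1, ℂ)

lemma memLp_IccExtend (f : C01) :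
    MemLp (IccExtend (zero_le_one' ℝ) f) 2 (volume.restrict (Ioo (0 : ℝ) 1)) :=
  memLp_of_continuousOn f.continuous.Icc_extend'.continuousOn 2

/-- The embedding of `C[0, 1]` into `L²(0, 1)`. -/
def toL2 : C01 →L[ℝ] L2 :=
  LinearMap.mkContinuous
    { toFun := fun f => (memLp_IccExtend f).toLp _
      map_add' := fun f g => by
        rw [← MemLp.toLp_add]
        rfl
      map_smul' := fun r f => by
        rw [RingHom.id_apply, ← MemLp.toLp_const_smul]
        rfl }
    _ fun f => Lp.norm_le_of_ae_bound (norm_nonneg f) (by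
      filter_upwards [MemLp.coeFn_toLp (memLp_IccExtend f)] with x hx
      refine hx ▸ ?_
      exact f.norm_coe_le_norm _)

lemma coeFn_toL2 (f : C01) : ∀ᵐ x ∂(volume.restrict (Ioo (0 : ℝ) 1)),
    ∀ hx : x ∈ Icc (0 : ℝ) 1, toL2 f x = f ⟨x, hx⟩ := by
  filter_upwards [MemLp.coeFn_toLp (memLp_IccExtend f)] with x hx hx'
  exact hx.trans (IccExtend_of_mem _ _ hx')

lemma continuous_primitive (f : L2) :
    Continuous fun x : Icc (0 : ℝ) 1 => ∫ t in (0 : ℝ)..x, f t := by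
  have := intervalIntegral.continuousOn_primitive_interval (μ := volume) (f := f)
    (a := 0) (b := 1) (by rw [uIcc_of_le zero_le_one]; exact integrableOn_Icc_of_Lp f)
  rw [uIcc_of_le zero_le_one] at this
  exact continuousOn_iff_continuous_domRestrict.1 this

/-- The operator `f ↦ ∫₀ˣ f` from `L²(0, 1)` to `C[0, 1]`. -/
def primitive : L2 →L[ℝ] C01 :=
  LinearMap.mkContinuous
    { toFun := fun f => ⟨fun x => ∫ t in (0 : ℝ)..x, f t, continuous_primitive f⟩
      map_add' := fun f g => by
        ext x
        exact L2.integral_add f g x.2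
      map_smul' := fun r f => by
        ext x
        exact L2.integral_smul r f x.2 }
    _ fun f => by
      refine le_trans ?_ (integral_norm_le_mul_norm f)
      refine (ContinuousMap.norm_le _ (integral_nonneg fun _ => norm_nonneg _)).2 fun x => ?_
      change ‖∫ t in (0 : ℝ)..x, f t‖ ≤ _
      rw [intervalIntegral.integral_of_le x.2.1, integral_Ioc_eq_integral_Ioo]
      refine (norm_integral_le_integral_norm _).trans (setIntegral_mono_set ?_
        (ae_of_all _ fun _ => norm_nonneg _)
        (LE.le.eventuallyLE (Ioo_subset_Ioo_right x.2.2)))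
      exact ((Lp.memLp f).integrable (by norm_num)).norm

/-- The operator `f ↦ f''` from `H²(0, 1)` to `L²(0, 1)`. -/
def secondDeriv : H2zero →L[ℝ] L2 :=
  (PiLp.proj 2 (fun _ : Fin 3 => L2) (2 : Fin 3) : PiLp 2 (fun _ : Fin 3 => L2) →L[ℝ] L2) ∘L
    H2zero.subtypeL

/-- The operator `f ↦ f'` from `H²(0, 1)` to `C[0, 1]`. -/
def firstDeriv : H2zero →L[ℝ] C01 := primitive ∘L secondDeriv

lemma memLp_weight (lam : ℝ) :
    MemLp (fun x : ℝ => Real.exp (-(lam * x))) ∞ (volume.restrict (Ioo (0 : ℝ) 1)) :=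
  memLp_of_continuousOn (by fun_prop) ∞

/-- Multiplication by the Carleman weight `exp(-λ x)` on `L²(0, 1)`. -/
def weightMul (lam : ℝ) : L2 →L[ℝ] L2 :=
  (ContinuousLinearMap.lsmul ℝ ℝ : ℝ →L[ℝ] ℂ →L[ℝ] ℂ).holderL
    (volume.restrict (Ioo (0 : ℝ) 1)) ∞ 2 2 ((memLp_weight lam).toLp _)

lemma coeFn_weightMul (lam : ℝ) (f : L2) :
    weightMul lam f =ᵐ[volume.restrict (Ioo (0 : ℝ) 1)]
      fun x => Real.exp (-(lam * x)) • f x := by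
  filter_upwards [(ContinuousLinearMap.lsmul ℝ ℝ : ℝ →L[ℝ] ℂ →L[ℝ] ℂ).coeFn_holder (r := 2)
    ((memLp_weight lam).toLp _) f, MemLp.coeFn_toLp (memLp_weight lam)] with x h1 h2
  rw [h2] at h1
  exact h1

lemma norm_weightMul_le {lam : ℝ} (hlam : 0 ≤ lam) : ‖weightMul lam‖ ≤ 1 := by
  refine ContinuousLinearMap.opNorm_le_bound _ zero_le_one fun f => ?_
  rw [one_mul]
  refine Lp.norm_le_norm_of_ae_le ?_
  filter_upwards [coeFn_weightMul lam f, ae_mem_Icc] with x hx hI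
  rw [hx, norm_smul, Real.norm_of_nonneg (Real.exp_nonneg _)]
  refine mul_le_of_le_one_left (norm_nonneg _) (Real.exp_le_one_iff.2 ?_)
  have := mul_nonneg hlam hI.1
  linarith

/-! ### The quadratic map behind `L` -/

section CostFunctional

variable {k₁ k₂ : ℝ}

/-- The space of the triples `(p'' + m'', p' + m', T_p)`, on which `L` acts as a quadratic map. -/
abbrev Triple (k₁ k₂ : ℝ) : Type :=
  Lp L2 2 (volume.restrict (Ioo k₁ k₂)) ×
    (Lp C01 2 (volume.restrict (Ioo k₁ k₂)) × Lp C01 ∞ (volume.restrict (Ioo k₁ k₂)))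

/-- The component `p'' + m''`. -/
def Triple.fstL : Triple k₁ k₂ →L[ℝ] Lp L2 2 (volume.restrict (Ioo k₁ k₂)) :=
  ContinuousLinearMap.fst ℝ _ _

/-- The component `p' + m'`. -/
def Triple.sndL : Triple k₁ k₂ →L[ℝ] Lp C01 2 (volume.restrict (Ioo k₁ k₂)) :=
  (ContinuousLinearMap.fst ℝ _ _) ∘L (ContinuousLinearMap.snd ℝ _ _)

/-- The component `T_p`. -/
def Triple.tailL : Triple k₁ k₂ →L[ℝ] Lp C01 ∞ (volume.restrict (Ioo k₁ k₂)) :=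
  (ContinuousLinearMap.snd ℝ _ _) ∘L (ContinuousLinearMap.snd ℝ _ _)

/-- A complex valued function of `k`, as a function with values in the constants of `C[0, 1]`. -/
def constLp (q : ℝ≥0∞) {φ : ℝ → ℂ} (hφ : Continuous φ) :
    Lp C01 q (volume.restrict (Ioo k₁ k₂)) :=
  (memLp_of_continuousOn (f := fun k => (ContinuousMap.const _ (φ k) : C01))
    (ContinuousMap.continuous_const'.comp hφ).continuousOn q).toLp _

lemma coeFn_constLp (q : ℝ≥0∞) {φ : ℝ → ℂ} (hφ : Continuous φ) :
    (constLp q hφ : Lp C01 q (volume.restrict (Ioo k₁ k₂)))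
      =ᵐ[volume.restrict (Ioo k₁ k₂)] fun k => ContinuousMap.const _ (φ k) :=
  MemLp.coeFn_toLp _

variable (k₁ k₂) in
/-- Pointwise multiplication of an `L^∞` function by an `L²` function of `k`, with values in the
algebra `C[0, 1]`. -/
def mulL : Lp C01 ∞ (volume.restrict (Ioo k₁ k₂)) →L[ℝ] Lp C01 2 (volume.restrict (Ioo k₁ k₂))
    →L[ℝ] Lp C01 2 (volume.restrict (Ioo k₁ k₂)) :=
  (ContinuousLinearMap.mul ℝ C01).holderL (volume.restrict (Ioo k₁ k₂)) ∞ 2 2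

lemma coeFn_mulL (f : Lp C01 ∞ (volume.restrict (Ioo k₁ k₂)))
    (g : Lp C01 2 (volume.restrict (Ioo k₁ k₂))) :
    mulL k₁ k₂ f g =ᵐ[volume.restrict (Ioo k₁ k₂)] fun k => f k * g k :=
  (ContinuousLinearMap.mul ℝ C01).coeFn_holder (r := 2) f g

variable (k₁ k₂) in
/-- `(u, T) ↦ -2 i k u - 2 i T`, the linear part of `L` without `p'' + m''`. -/
def lowerLinear : Triple k₁ k₂ →L[ℝ] Lp C01 2 (volume.restrict (Ioo k₁ k₂)) :=
  mulL k₁ k₂ (constLp ∞ (φ := fun k => -(2 * Complex.I * k)) (by fun_prop)) ∘L Triple.sndL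
    + (mulL k₁ k₂).flip (constLp 2 (φ := fun _ => -(2 * Complex.I)) (by fun_prop)) ∘L Triple.tailL

variable (k₁ k₂) in
/-- `(u, T) ↦ 2 k² u + 2 k T`, the factor by which `T` is multiplied in `L`. -/
def tailFactor : Triple k₁ k₂ →L[ℝ] Lp C01 2 (volume.restrict (Ioo k₁ k₂)) :=
  mulL k₁ k₂ (constLp ∞ (φ := fun k => 2 * (k : ℂ) ^ 2) (by fun_prop)) ∘L Triple.sndL
    + (mulL k₁ k₂).flip (constLp 2 (φ := fun k => 2 * (k : ℂ)) (by fun_prop)) ∘L Triple.tailL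

variable (k₁ k₂) in
/-- `toL2`, applied for each `k`. -/
def toL2L : Lp C01 2 (volume.restrict (Ioo k₁ k₂)) →L[ℝ] Lp L2 2 (volume.restrict (Ioo k₁ k₂)) :=
  toL2.compLpL 2 _

variable (k₁ k₂) in
/-- The linear part of `L` as a map of the triple `(p'' + m'', p' + m', T_p)`. -/
def linearPart : Triple k₁ k₂ →L[ℝ] Lp L2 2 (volume.restrict (Ioo k₁ k₂)) :=
  Triple.fstL + toL2L k₁ k₂ ∘L lowerLinear k₁ k₂

variable (k₁ k₂) in
/-- The bilinear form whose diagonal is the quadratic part of `L`. -/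
def bilinearPart : Triple k₁ k₂ →L[ℝ] Triple k₁ k₂ →L[ℝ]
    Lp L2 2 (volume.restrict (Ioo k₁ k₂)) :=
  (ContinuousLinearMap.compL ℝ (Triple k₁ k₂) _ _ (toL2L k₁ k₂)) ∘L
    ((mulL k₁ k₂).bilinearComp Triple.tailL (tailFactor k₁ k₂))

lemma coeFn_lowerLinear (z : Triple k₁ k₂) :
    lowerLinear k₁ k₂ z =ᵐ[volume.restrict (Ioo k₁ k₂)] fun k =>
      ContinuousMap.const _ (-(2 * Complex.I * k)) * z.2.1 k
        + z.2.2 k * ContinuousMap.const _ (-(2 * Complex.I)) := by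
  filter_upwards [Lp.coeFn_add
      (mulL k₁ k₂ (constLp ∞ (φ := fun k => -(2 * Complex.I * k)) (by fun_prop)) z.2.1)
      (mulL k₁ k₂ z.2.2 (constLp 2 (φ := fun _ => -(2 * Complex.I)) (by fun_prop))),
    coeFn_mulL (constLp ∞ (φ := fun k => -(2 * Complex.I * k)) (by fun_prop)) z.2.1,
    coeFn_mulL z.2.2 (constLp 2 (φ := fun _ => -(2 * Complex.I)) (by fun_prop)),
    coeFn_constLp (k₁ := k₁) (k₂ := k₂) ∞ (φ := fun k => -(2 * Complex.I * k)) (by fun_prop),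
    coeFn_constLp (k₁ := k₁) (k₂ := k₂) 2 (φ := fun _ => -(2 * Complex.I)) (by fun_prop)]
    with k h h1 h2 h3 h4
  rw [Pi.add_apply, h1, h2, h3, h4] at h
  exact h

lemma coeFn_tailFactor (z : Triple k₁ k₂) :
    tailFactor k₁ k₂ z =ᵐ[volume.restrict (Ioo k₁ k₂)] fun k =>
      ContinuousMap.const _ (2 * (k : ℂ) ^ 2) * z.2.1 k
        + z.2.2 k * ContinuousMap.const _ (2 * (k : ℂ)) := by
  filter_upwards [Lp.coeFn_add
      (mulL k₁ k₂ (constLp ∞ (φ := fun k => 2 * (k : ℂ) ^ 2) (by fun_prop)) z.2.1)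
      (mulL k₁ k₂ z.2.2 (constLp 2 (φ := fun k => 2 * (k : ℂ)) (by fun_prop))),
    coeFn_mulL (constLp ∞ (φ := fun k => 2 * (k : ℂ) ^ 2) (by fun_prop)) z.2.1,
    coeFn_mulL z.2.2 (constLp 2 (φ := fun k => 2 * (k : ℂ)) (by fun_prop)),
    coeFn_constLp (k₁ := k₁) (k₂ := k₂) ∞ (φ := fun k => 2 * (k : ℂ) ^ 2) (by fun_prop),
    coeFn_constLp (k₁ := k₁) (k₂ := k₂) 2 (φ := fun k => 2 * (k : ℂ)) (by fun_prop)]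
    with k h h1 h2 h3 h4
  rw [Pi.add_apply, h1, h2, h3, h4] at h
  exact h

/-- The quadratic map evaluated pointwise. -/
lemma coeFn_linearPart_add_bilinearPart (z : Triple k₁ k₂) :
    ∀ᵐ k ∂(volume.restrict (Ioo k₁ k₂)), ∀ᵐ x ∂(volume.restrict (Ioo (0 : ℝ) 1)),
      ∀ hx : x ∈ Icc (0 : ℝ) 1, (linearPart k₁ k₂ z + bilinearPart k₁ k₂ z z) k x
        = z.1 k x - 2 * Complex.I * k * z.2.1 k ⟨x, hx⟩
          + 2 * (k : ℂ) ^ 2 * z.2.1 k ⟨x, hx⟩ * z.2.2 k ⟨x, hx⟩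
          - 2 * Complex.I * z.2.2 k ⟨x, hx⟩ + 2 * (k : ℂ) * z.2.2 k ⟨x, hx⟩ ^ 2 := by
  filter_upwards [Lp.coeFn_add (linearPart k₁ k₂ z) (bilinearPart k₁ k₂ z z),
    Lp.coeFn_add z.1 (toL2L k₁ k₂ (lowerLinear k₁ k₂ z)),
    toL2.coeFn_compLpL (p := 2) (lowerLinear k₁ k₂ z),
    toL2.coeFn_compLpL (p := 2) (mulL k₁ k₂ z.2.2 (tailFactor k₁ k₂ z)),
    coeFn_mulL z.2.2 (tailFactor k₁ k₂ z), coeFn_lowerLinear z, coeFn_tailFactor z]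
    with k h1 h2 h3 h4 h5 h6 h7
  have e : (linearPart k₁ k₂ z + bilinearPart k₁ k₂ z z) k
      = z.1 k + toL2 (lowerLinear k₁ k₂ z k) + toL2 (z.2.2 k * tailFactor k₁ k₂ z k) := by
    rw [h1, Pi.add_apply, ← h5, ← h3, ← h4]
    exact congrArg (· + _) h2
  rw [e, h6, h7]
  filter_upwards [Lp.coeFn_add (z.1 k + toL2 (ContinuousMap.const _ (-(2 * Complex.I * k)) * z.2.1 k
        + z.2.2 k * ContinuousMap.const _ (-(2 * Complex.I))))
      (toL2 (z.2.2 k * (ContinuousMap.const _ (2 * (k : ℂ) ^ 2) * z.2.1 k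
        + z.2.2 k * ContinuousMap.const _ (2 * (k : ℂ))))),
    Lp.coeFn_add (z.1 k) (toL2 (ContinuousMap.const _ (-(2 * Complex.I * k)) * z.2.1 k
        + z.2.2 k * ContinuousMap.const _ (-(2 * Complex.I)))),
    coeFn_toL2 (ContinuousMap.const _ (-(2 * Complex.I * k)) * z.2.1 k
        + z.2.2 k * ContinuousMap.const _ (-(2 * Complex.I))),
    coeFn_toL2 (z.2.2 k * (ContinuousMap.const _ (2 * (k : ℂ) ^ 2) * z.2.1 k
        + z.2.2 k * ContinuousMap.const _ (2 * (k : ℂ))))] with x g1 g2 g3 g4 hx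
  rw [g1, Pi.add_apply, g2, Pi.add_apply, g3 hx, g4 hx]
  simp only [ContinuousMap.add_apply, ContinuousMap.mul_apply, ContinuousMap.const_apply]
  ring

/-! ### The affine dependence on `p` -/

/-- The linear part of `p ↦ (p'' + m'', p' + m', T_p)`. -/
def tripleLinear (hlt : k₁ < k₂) : H k₁ k₂ →L[ℝ] Triple k₁ k₂ :=
  (secondDeriv.compLpL 2 _).prod
    ((firstDeriv.compLpL 2 _).prod (-(tailIntegral C01 hlt ∘L firstDeriv.compLpL 2 _)))

/-- `∂ₓ (x² - 1)²`. -/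
def d₀ : C01 := ⟨fun x => 4 * ((x : ℝ) : ℂ) * (((x : ℝ) : ℂ) ^ 2 - 1), by fun_prop⟩

/-- `∂ₓ (x (x² - 1)²)`. -/
def d₁ : C01 := ⟨fun x => (((x : ℝ) : ℂ) ^ 2 - 1) ^ 2
  + 4 * ((x : ℝ) : ℂ) ^ 2 * (((x : ℝ) : ℂ) ^ 2 - 1), by fun_prop⟩

/-- `∂ₓ² (x² - 1)²`. -/
def dd₀ : C01 := ⟨fun x => 12 * ((x : ℝ) : ℂ) ^ 2 - 4, by fun_prop⟩

/-- `∂ₓ² (x (x² - 1)²)`. -/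
def dd₁ : C01 := ⟨fun x => 20 * ((x : ℝ) : ℂ) ^ 3 - 12 * ((x : ℝ) : ℂ), by fun_prop⟩

lemma mx_eq (g₀ ℓ : ℝ → ℂ) (x k : ℝ) : mx k₁ k₂ g₀ ℓ x k
    = p₀ k₁ k₂ ℓ k * (4 * (x : ℂ) * ((x : ℂ) ^ 2 - 1))
      + p₁ k₁ k₂ g₀ k * (((x : ℂ) ^ 2 - 1) ^ 2 + 4 * (x : ℂ) ^ 2 * ((x : ℂ) ^ 2 - 1)) := by
  have hid : HasDerivAt (fun y : ℝ => (y : ℂ)) 1 x := Complex.ofRealCLM.hasDerivAt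
  have h := (((hid.pow 2).sub_const 1).pow 2)
  refine ((h.mul_const (p₀ k₁ k₂ ℓ k)).add
    ((hid.mul h).mul_const (p₁ k₁ k₂ g₀ k))).deriv.trans ?_
  simp
  ring

lemma mxx_eq (g₀ ℓ : ℝ → ℂ) (x k : ℝ) : mxx k₁ k₂ g₀ ℓ x k
    = p₀ k₁ k₂ ℓ k * (12 * (x : ℂ) ^ 2 - 4)
      + p₁ k₁ k₂ g₀ k * (20 * (x : ℂ) ^ 3 - 12 * (x : ℂ)) := by
  have hid : HasDerivAt (fun y : ℝ => (y : ℂ)) 1 x := Complex.ofRealCLM.hasDerivAt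
  have h := ((hid.pow 2).sub_const 1)
  unfold mxx
  simp only [mx_eq]
  refine ((((hid.const_mul 4).mul h).const_mul (p₀ k₁ k₂ ℓ k)).add
    (((h.pow 2).add (((hid.pow 2).const_mul 4).mul h)).const_mul
      (p₁ k₁ k₂ g₀ k))).deriv.trans ?_
  simp
  ring

lemma memLp_comb {P Q : ℝ → ℂ} (hP : ContinuousOn P (Icc k₁ k₂)) (hQ : ContinuousOn Q (Icc k₁ k₂))
    (f g : C01) : MemLp (fun k => P k • f + Q k • g) 2 (volume.restrict (Ioo k₁ k₂)) :=
  memLp_of_continuousOn ((hP.smul continuousOn_const).add (hQ.smul continuousOn_const)) 2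

/-- `k ↦ P(k) f + Q(k) g` as an element of `L²((k₁, k₂); C[0, 1])`. -/
def comb {P Q : ℝ → ℂ} (hP : ContinuousOn P (Icc k₁ k₂)) (hQ : ContinuousOn Q (Icc k₁ k₂))
    (f g : C01) : Lp C01 2 (volume.restrict (Ioo k₁ k₂)) :=
  (memLp_comb hP hQ f g).toLp _

lemma norm_comb_le {P Q : ℝ → ℂ} (hP : ContinuousOn P (Icc k₁ k₂))
    (hQ : ContinuousOn Q (Icc k₁ k₂)) (f g : C01) {K : ℝ}
    (hK : ∀ k ∈ Icc k₁ k₂, ‖P k‖ ≤ K ∧ ‖Q k‖ ≤ K) (hK0 : 0 ≤ K) :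
    ‖comb hP hQ f g‖ ≤ measureUnivNNReal (volume.restrict (Ioo k₁ k₂)) ^ (2 : ℝ≥0∞).toReal⁻¹
      * (K * ‖f‖ + K * ‖g‖) := by
  refine Lp.norm_le_of_ae_bound (by positivity) ?_
  filter_upwards [MemLp.coeFn_toLp (memLp_comb hP hQ f g), ae_restrict_mem measurableSet_Ioo]
    with k hk hk'
  rw [comb, hk]
  have := hK k (Ioo_subset_Icc_self hk')
  refine (norm_add_le _ _).trans (add_le_add ?_ ?_)
  · rw [norm_smul]; gcongr; exact this.1
  · rw [norm_smul]; gcongr; exact this.2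

/-- The extension to `k`-independent functions of the restriction of `v` to `[0, 1]`. -/
def tailConst {v : ℝ → ℂ} (hv : ContinuousOn v (Icc 0 1)) :
    Lp C01 ∞ (volume.restrict (Ioo k₁ k₂)) :=
  (memLp_const (⟨_, continuousOn_iff_continuous_domRestrict.1 hv⟩ : C01)).toLp _

/-- The value of `p ↦ (p'' + m'', p' + m', T_p)` at `p = 0`. -/
def tripleShift (hlt : k₁ < k₂) {P Q v : ℝ → ℂ} (hP : ContinuousOn P (Icc k₁ k₂))
    (hQ : ContinuousOn Q (Icc k₁ k₂)) (hv : ContinuousOn v (Icc 0 1)) : Triple k₁ k₂ :=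
  (toL2L k₁ k₂ (comb hP hQ dd₀ dd₁), comb hP hQ d₀ d₁,
    -tailIntegral C01 hlt (comb hP hQ d₀ d₁) + tailConst hv)

lemma exists_norm_tripleShift_le (hlt : k₁ < k₂) {K : ℝ} (hK : 0 ≤ K) :
    ∃ K' : ℝ, 0 ≤ K' ∧ ∀ (P Q v : ℝ → ℂ) (hP : ContinuousOn P (Icc k₁ k₂))
      (hQ : ContinuousOn Q (Icc k₁ k₂)) (hv : ContinuousOn v (Icc 0 1)),
      (∀ k ∈ Icc k₁ k₂, ‖P k‖ ≤ K ∧ ‖Q k‖ ≤ K) → (∀ x ∈ Icc (0 : ℝ) 1, ‖v x‖ ≤ K) →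
        ‖tripleShift hlt hP hQ hv‖ ≤ K' := by
  set κ : ℝ := measureUnivNNReal (volume.restrict (Ioo k₁ k₂)) ^ (2 : ℝ≥0∞).toReal⁻¹
  set A := κ * (K * ‖d₀‖ + K * ‖d₁‖)
  set B := κ * (K * ‖dd₀‖ + K * ‖dd₁‖)
  refine ⟨max (‖toL2L k₁ k₂‖ * B) (max A (‖tailIntegral C01 hlt‖ * A + K)),
    le_max_of_le_left (by positivity), fun P Q v hP hQ hv hPQ hvK => ?_⟩
  have hA := norm_comb_le hP hQ d₀ d₁ hPQ hK
  have hB := norm_comb_le hP hQ dd₀ dd₁ hPQ hK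
  have hV : ‖(tailConst hv : Lp C01 ∞ (volume.restrict (Ioo k₁ k₂)))‖ ≤ K := by
    have h := Lp.norm_le_of_ae_bound (p := ∞)
      (f := (tailConst hv : Lp C01 ∞ (volume.restrict (Ioo k₁ k₂)))) hK (by
        filter_upwards [MemLp.coeFn_toLp (memLp_const (p := ∞) (μ := volume.restrict (Ioo k₁ k₂))
          (⟨_, continuousOn_iff_continuous_domRestrict.1 hv⟩ : C01))] with k hk
        rw [tailConst, hk]
        exact (ContinuousMap.norm_le _ hK).2 fun x => hvK x x.2)
    simpa only [ENNReal.toReal_top, inv_zero, Real.rpow_zero, one_mul] using h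
  refine max_le_max ?_ (max_le_max hA ?_)
  · exact ((toL2L k₁ k₂).le_opNorm _).trans (by gcongr)
  · refine (norm_add_le _ _).trans (add_le_add ?_ hV)
    rw [norm_neg]
    exact ((tailIntegral C01 hlt).le_opNorm _).trans (by gcongr)

end CostFunctional

/-! ### The cost functional as a squared norm -/

section Identification

variable {k₁ k₂ : ℝ}

/-- `L(p)` is the quadratic map evaluated at the triple of `p`. All equalities hold for almost
every `x` for almost every `k`: no joint measurability in `(x, k)` is available or needed. -/
lemma opL_ae_eq (hlt : k₁ < k₂) {g₀ ℓ v : ℝ → ℂ} (hP : ContinuousOn (p₀ k₁ k₂ ℓ) (Icc k₁ k₂))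
    (hQ : ContinuousOn (p₁ k₁ k₂ g₀) (Icc k₁ k₂)) (hv : ContinuousOn v (Icc 0 1))
    (p : H k₁ k₂) :
    ∀ᵐ k ∂(volume.restrict (Ioo k₁ k₂)), ∀ᵐ x ∂(volume.restrict (Ioo (0 : ℝ) 1)),
      opL g₀ ℓ v p x k = (linearPart k₁ k₂ (tripleLinear hlt p + tripleShift hlt hP hQ hv)
        + bilinearPart k₁ k₂ (tripleLinear hlt p + tripleShift hlt hP hQ hv)
          (tripleLinear hlt p + tripleShift hlt hP hQ hv)) k x := by
  set z := tripleLinear hlt p + tripleShift hlt hP hQ hv with hz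
  set U : Lp C01 2 (volume.restrict (Ioo k₁ k₂)) :=
    firstDeriv.compLpL 2 _ p + comb hP hQ d₀ d₁ with hU
  have hz1 : z.1 = secondDeriv.compLpL 2 _ p + toL2L k₁ k₂ (comb hP hQ dd₀ dd₁) := rfl
  have hz2 : z.2.1 = U := rfl
  have hz3 : z.2.2 = -tailIntegral C01 hlt U + tailConst hv := by
    rw [hU, map_add, neg_add, add_assoc]
    rfl
  have hUae : ∀ᵐ k ∂(volume.restrict (Ioo k₁ k₂)), ∀ x, ∀ hx : x ∈ Icc (0 : ℝ) 1,
      U k ⟨x, hx⟩ = dx p x k + mx k₁ k₂ g₀ ℓ x k := by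
    filter_upwards [Lp.coeFn_add (firstDeriv.compLpL 2 _ p) (comb hP hQ d₀ d₁),
      firstDeriv.coeFn_compLpL (p := 2) p, MemLp.coeFn_toLp (memLp_comb hP hQ d₀ d₁)]
      with k h1 h2 h3 x hx
    rw [h1, Pi.add_apply, h2, comb, h3, mx_eq]
    rfl
  have hT : ∀ᵐ k ∂(volume.restrict (Ioo k₁ k₂)), ∀ x, ∀ hx : x ∈ Icc (0 : ℝ) 1,
      z.2.2 k ⟨x, hx⟩ = tailTerm g₀ ℓ v p x k := by
    rw [hz3]
    filter_upwards [Lp.coeFn_add (-tailIntegral C01 hlt U) (tailConst hv),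
      Lp.coeFn_neg (tailIntegral C01 hlt U), coeFn_tailIntegral hlt U,
      MemLp.coeFn_toLp (memLp_const (p := ∞) (μ := volume.restrict (Ioo k₁ k₂))
        (⟨_, continuousOn_iff_continuous_domRestrict.1 hv⟩ : C01)),
      ae_restrict_mem measurableSet_Ioo] with k h1 h2 h3 h4 hk x hx
    rw [h1, Pi.add_apply, h2, Pi.neg_apply, h3, tailConst, h4]
    have hev := ((ContinuousMap.evalCLM ℝ (⟨x, hx⟩ : Icc (0 : ℝ) 1)) :
      C01 →L[ℝ] ℂ).intervalIntegral_comp_comm (intervalIntegrable_of_Lp U hk)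
    have hcongr := intervalIntegral_congr_ae_restrict (F := ℂ)
      (f := fun τ => U τ ⟨x, hx⟩) (g := fun τ => dx p x τ + mx k₁ k₂ g₀ ℓ x τ) (by
        filter_upwards [hUae] with τ hτ using hτ x hx) hk
    rw [tailTerm, ← hcongr]
    refine congrArg (fun a : ℂ => -a + v x) ?_
    exact hev.symm
  filter_upwards [coeFn_linearPart_add_bilinearPart z, hUae, hT,
    Lp.coeFn_add (secondDeriv.compLpL 2 _ p) (toL2L k₁ k₂ (comb hP hQ dd₀ dd₁)),
    secondDeriv.coeFn_compLpL (p := 2) p, toL2.coeFn_compLpL (p := 2) (comb hP hQ dd₀ dd₁),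
    MemLp.coeFn_toLp (memLp_comb hP hQ dd₀ dd₁)] with k h1 h2 h3 h4 h5 h6 h7
  have e : z.1 k = secondDeriv (p k)
      + toL2 (p₀ k₁ k₂ ℓ k • dd₀ + p₁ k₁ k₂ g₀ k • dd₁) := by
    rw [hz1, h4, Pi.add_apply, h5, ← h7]
    exact congrArg (_ + ·) h6
  filter_upwards [h1, Lp.coeFn_add (secondDeriv (p k))
      (toL2 (p₀ k₁ k₂ ℓ k • dd₀ + p₁ k₁ k₂ g₀ k • dd₁)),
    coeFn_toL2 (p₀ k₁ k₂ ℓ k • dd₀ + p₁ k₁ k₂ g₀ k • dd₁), ae_mem_Icc] with x f1 f2 f3 hx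
  rw [f1 hx, e, f2, Pi.add_apply, f3 hx, hz2, h2 x hx, h3 x hx, opL, mxx_eq]
  rfl

/-- The cost functional is `e^{2λ}` times the squared `L²`-norm of `L(p)`, multiplied by the
weight. -/
lemma J_eq (hlt : k₁ < k₂) {g₀ ℓ v : ℝ → ℂ} (hP : ContinuousOn (p₀ k₁ k₂ ℓ) (Icc k₁ k₂))
    (hQ : ContinuousOn (p₁ k₁ k₂ g₀) (Icc k₁ k₂)) (hv : ContinuousOn v (Icc 0 1)) (lam : ℝ)
    (p : H k₁ k₂) :
    J g₀ ℓ v lam p = Real.exp (2 * lam) * ‖(weightMul lam).compLpL 2 (volume.restrict (Ioo k₁ k₂))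
      (linearPart k₁ k₂ (tripleLinear hlt p + tripleShift hlt hP hQ hv)
        + bilinearPart k₁ k₂ (tripleLinear hlt p + tripleShift hlt hP hQ hv)
          (tripleLinear hlt p + tripleShift hlt hP hQ hv))‖ ^ 2 := by
  rw [J, norm_sq_eq_integral, intervalIntegral.integral_of_le hlt.le, integral_Ioc_eq_integral_Ioo]
  congr 1
  refine integral_congr_ae ?_
  filter_upwards [opL_ae_eq hlt hP hQ hv p,
    (weightMul lam).coeFn_compLpL (p := 2) (μ := volume.restrict (Ioo k₁ k₂))
      (linearPart k₁ k₂ (tripleLinear hlt p + tripleShift hlt hP hQ hv)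
        + bilinearPart k₁ k₂ (tripleLinear hlt p + tripleShift hlt hP hQ hv)
          (tripleLinear hlt p + tripleShift hlt hP hQ hv))] with k h1 h2
  rw [h2, norm_sq_eq_integral, intervalIntegral.integral_of_le zero_le_one,
    integral_Ioc_eq_integral_Ioo]
  refine integral_congr_ae ?_
  filter_upwards [h1, coeFn_weightMul lam ((linearPart k₁ k₂
      (tripleLinear hlt p + tripleShift hlt hP hQ hv)
        + bilinearPart k₁ k₂ (tripleLinear hlt p + tripleShift hlt hP hQ hv)
          (tripleLinear hlt p + tripleShift hlt hP hQ hv)) k)] with x f1 f2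
  rw [f1, f2, norm_smul, mul_pow, mul_comm, Real.norm_of_nonneg (Real.exp_nonneg _),
    ← Real.exp_nat_mul]
  congr 2
  push_cast
  ring

end Identification

end HelmholtzCIP

end

theorem theorem5p1 (x₀ k₁ k₂ R M : ℝ) (r : ℝ → ℂ)
    (hx₀ : x₀ < 0) (hk₁ : 0 < k₁) (hk : k₁ < k₂) (hR : 0 < R) :
    ∃ C₂ : ℝ, 0 < C₂ ∧
      ∀ (c : ℝ → ℝ) (u ψ : ℝ → ℝ → ℂ) (δ : ℝ) (g₀ ℓ : ℝ → ℂ) (V : ℕ → ℝ → ℂ),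
        -- the exact coefficient, its field, `log w*`, and `r*`
        HelmholtzCIP.IsDielectric c →
        (∀ k : ℝ, 0 < k → HelmholtzCIP.IsHelmholtzSolution c x₀ k (fun x => u x k)) →
        HelmholtzCIP.IsLogWave c x₀ (HelmholtzCIP.wave x₀ u) ψ →
        (∀ x ∈ Set.Icc (0 : ℝ) 1, ψ x k₂ / (k₂ : ℂ) ^ 2 = r x / (k₂ : ℂ)) →
        -- the noisy data
        0 < δ → δ ≤ 1 →
        HelmholtzCIP.IsData k₁ k₂ g₀ ℓ →
        HelmholtzCIP.NoiseLevel k₁ k₂ δ g₀ ℓ (HelmholtzCIP.wave x₀ u 0) (ψ 0) →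
        (∀ k ∈ Set.Icc k₁ k₂, ‖HelmholtzCIP.p₁ k₁ k₂ g₀ k‖ ≤ M) →
        -- the approximate tail function, with `α = δ²`
        HelmholtzCIP.IsTailMinimizer (δ ^ 2) k₂ g₀ ℓ V →
        ∀ lam : ℝ, 0 < lam →
          Differentiable ℝ
            (HelmholtzCIP.J (k₁ := k₁) (k₂ := k₂) g₀ ℓ (V 1) lam) ∧
          ∀ p ∈ closure (Metric.ball (0 : HelmholtzCIP.H k₁ k₂) R),
            ∀ q ∈ closure (Metric.ball (0 : HelmholtzCIP.H k₁ k₂) R),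
              ‖gradient (HelmholtzCIP.J g₀ ℓ (V 1) lam) p
                  - gradient (HelmholtzCIP.J g₀ ℓ (V 1) lam) q‖
                ≤ C₂ * Real.exp (2 * lam) * ‖p - q‖ := by
  obtain ⟨K, hK0, hK⟩ := HelmholtzCIP.exists_data_bound x₀ k₁ k₂ M r hx₀ hk₁ hk
  obtain ⟨K', hK'0, hK'⟩ := HelmholtzCIP.exists_norm_tripleShift_le hk hK0
  obtain ⟨C, hC0, hC⟩ := HelmholtzCIP.exists_lipschitz_gradient_norm_sq
    (X := HelmholtzCIP.H k₁ k₂)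
    (HelmholtzCIP.linearPart k₁ k₂) (HelmholtzCIP.bilinearPart k₁ k₂)
    (HelmholtzCIP.tripleLinear hk) hR.le hK'0
  refine ⟨C, hC0, ?_⟩
  intro c u ψ δ g₀ ℓ V hc hu _ hr hδ hδ1 hd hn hM hV lam hlam
  obtain ⟨hpK, hvK⟩ := hK c u ψ δ g₀ ℓ V hc hu hr hδ hδ1 hd hn hM hV
  have hP := hd.continuousOn_p₀ hk₁ hk
  have hQ := hd.continuousOn_p₁ hk₁ hk
  have hv : ContinuousOn (V 1) (Set.Icc 0 1) := hV.1.1.continuousOn (n := 2) (by norm_num)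
  obtain ⟨hdiff, hlip⟩ := hC (HelmholtzCIP.tripleShift hk hP hQ hv)
    ((HelmholtzCIP.weightMul lam).compLpL 2 (volume.restrict (Ioo k₁ k₂))) (Real.exp (2 * lam))
    (hK' _ _ _ hP hQ hv hpK hvK)
    ((ContinuousLinearMap.norm_compLpL_le _).trans (HelmholtzCIP.norm_weightMul_le hlam.le))
    (Real.exp_nonneg _) (HelmholtzCIP.J g₀ ℓ (V 1) lam)
    (HelmholtzCIP.J_eq hk hP hQ hv lam)
  have hball : ∀ p ∈ closure (Metric.ball (0 : HelmholtzCIP.H k₁ k₂) R), ‖p‖ ≤ R := fun p hp => by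
    have h := Metric.mem_closedBall.1 (Metric.closure_ball_subset_closedBall hp)
    rwa [dist_eq_norm, sub_zero] at h
  exact ⟨hdiff, fun p hp q hq => hlip p q (hball p hp) (hball q hq)⟩
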